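/- For a map $\phi:X\to Y$ between metric spaces let $\|\phi\|_{\mathrm{Lip}(X;Y)}\in[0,\infty]$ be the infimum of those $L\in[0,\infty]$ with $d_Y(\phi(x),\phi(y))\le L\,d_X(x,y)$ for all $x,y\in X$. For metric spaces $M,N$ and $S\subseteq M$ let $e(M,S;N)\in[1,\infty]$ be the infimum of those $K\in[1,\infty]$ such that every $\phi:S\to N$ with $\|\phi\|_{\mathrm{Lip}(S;N)}<\infty$ extends to some $\Phi:M\to N$ with $\|\Phi\|_{\mathrm{Lip}(M;N)}\le K\|\phi\|_{\mathrm{Lip}(S;N)}$. For $n\in\mathbb N$ let $e^n(M;N)\in[1,\infty]$ be the supremum (in $[1,\infty]$) of $e(S\cup\{x_1,\dots,x_n\},S;N)$ over all closed $S\subseteq M$ and all $x_1,\dots,x_n\in M\setminus S$. Let $\ell_p$ denote the Banach space of $p$-summable real sequences. There is a universal constant $K>0$, and for each $p\in(1,2]$ a constant $c(p)>0$ depending only on $p$, such that for every integer $n\ge 3$: 1. $e^n(M;Z)\le K\,\dfrac{\log n}{\log\log n}$ for every metric space $M$ and every Banach space $Z$; 2. $e^n(\ell_p;\ell_2)\le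 c(p)\,(\log n)^{\frac1p-\frac12}$ for every $p\in(1,2]$; 3. $e^n(\ell_2;Z)\le K\sqrt{\log n}$ for every Banach space $Z$; 4. $e^n(Z;\ell_2)\le K\sqrt{\log n}$ for every Banach space $Z$; 5. $e^n(\ell_p;Z)\le c(p)\,(\log n)^{1/p}$ for every $p\in(1,2]$ and every Banach space $Z$. -/

import Mathlib

open scoped ENNReal

/-- The Lipschitz constant, in `[0, ∞]`, of a map between metric spaces: the infimum of all
`L ∈ [0, ∞]` with `d (φ x) (φ y) ≤ L * d x y` for all `x, y`. -/
noncomputable def lipConst {X Y : Type*} [MetricSpace X] [MetricSpace Y] (φ : X → Y) : ℝ≥0∞ :=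
  sInf {L : ℝ≥0∞ | ∀ x y : X, edist (φ x) (φ y) ≤ L * edist x y}

/-- The Lipschitz extension modulus `e(M, S; N)`: the infimum of all `K ∈ [1, ∞]` such that every
Lipschitz map `φ : S → N` extends to a map `Φ : M → N` with `‖Φ‖_Lip ≤ K ‖φ‖_Lip`. -/
noncomputable def lipExt (M : Type*) [MetricSpace M] (S : Set M) (N : Type*) [MetricSpace N] :
    ℝ≥0∞ :=
  sInf {K : ℝ≥0∞ | 1 ≤ K ∧ ∀ φ : S → N, lipConst φ < ∞ →
    ∃ Φ : M → N, (∀ x : S, Φ x = φ x) ∧ lipConst Φ ≤ K * lipConst φ}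

/-- The modulus `e^n(M; N)`: the supremum of `e(S ∪ {x₁, …, xₙ}, S; N)` over all closed sets
`S ⊆ M` and all points `x₁, …, xₙ ∈ M \ S`. The supremum is taken in `[1, ∞]`, so it is `1` when
there is no such choice of `S, x₁, …, xₙ`. -/
noncomputable def lipExtAdd (n : ℕ) (M : Type*) [MetricSpace M] (N : Type*) [MetricSpace N] :
    ℝ≥0∞ :=
  1 ⊔ ⨆ (S : Set M) (_ : IsClosed S) (x : Fin n → M) (_ : ∀ i, x i ∉ S),
    lipExt (↥(S ∪ Set.range x)) (Subtype.val ⁻¹' S) N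

/-- The real sequence space `ℓ_p`. -/
abbrev ell (p : ℝ≥0∞) : Type := lp (fun _ : ℕ => ℝ) p

/-! Adding n points to a closed set reduces to a problem on at most 2n points: replace S by one
nearly closest point for each added point, extend from those, and glue (`lipExtAdd_le_of_finExt`).
Everything else bounds the constant in `FinExt` by the logarithm of the number of points.

For a Banach target, extend by averaging. In a general metric space, average over the part of T in a
ball around x whose radius is log-uniform between 2A and 2RA, where A is the distance from x to T.
Moving x by δ changes the uniform measure on the ball by at most a difference of logarithms of ball
sizes at radii r + δ and r - δ, and integrating over r telescopes. The cost is of order R + log m /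
log R, and R near √(log n) gives log n / log log n.

For a Hilbert source, a random sign matrix (Johnson–Lindenstrauss) reduces the dimension to d of
order log n. Averaging a nearest-point map against a Gaussian at scale A then costs √d, by a
chi-squared comparison of two nearby Gaussians. For a Hilbert target, the image of T is compressed
to dimension d, each coordinate is extended as a real function (total cost √d), and Kirszbraun's
theorem undoes the compression.

For ℓ_p with 1 < p < 2, multiply d copies of the coordinates by independent weights with tail
s^(-p), and measure the result in a Euclidean norm. With weight at least 1/2 no pair of the finite
set is contracted below √d/8, while the mean expansion is O(d^(1/p)). Extending from each good
Euclidean image and averaging the extensions loses d^(1/p - 1/2) over the Euclidean constant, which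
is 1 for target ℓ_2 (Kirszbraun) and O(√(log n)) for a Banach target. -/

/-- Finite extension property with constant `K`: whenever `T ⊆ N` are finite subsets of `M` with
`N` of cardinality at most `m`, every `L`-Lipschitz map on `T` extends to a `K * L`-Lipschitz map
on `N`. -/
def FinExt (M : Type*) [MetricSpace M] (Z : Type*) [MetricSpace Z] (m : ℕ) (K : ℝ) : Prop :=
  ∀ (T N : Finset M) (φ : M → Z) (L : ℝ), T.Nonempty → T ⊆ N → N.card ≤ m → 0 ≤ L →
    (∀ s ∈ T, ∀ t ∈ T, dist (φ s) (φ t) ≤ L * dist s t) →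
    ∃ Φ : M → Z, (∀ t ∈ T, Φ t = φ t) ∧
      ∀ x ∈ N, ∀ y ∈ N, dist (Φ x) (Φ y) ≤ K * L * dist x y

theorem FinExt.mono {M : Type*} [MetricSpace M] {Z : Type*} [MetricSpace Z] {m : ℕ} {K K' : ℝ}
    (h : FinExt M Z m K) (hK : K ≤ K') : FinExt M Z m K' := by
  intro T N φ L hT hTN hN hL hφ
  obtain ⟨Φ, h1, h2⟩ := h T N φ L hT hTN hN hL hφ
  refine ⟨Φ, h1, fun x hx y hy => (h2 x hx y hy).trans ?_⟩
  gcongr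

/-- A map that contracts no distance by more than `a` transports the extension problem to its image.
The conclusion keeps `dist (g x) (g y)` unestimated, so that g need only be controlled on average
when many such extensions are averaged. -/
theorem FinExt.pullback {M M' Z : Type*} [MetricSpace M] [MetricSpace M'] [MetricSpace Z]
    {m : ℕ} {K : ℝ} (h : FinExt M' Z m K) {T N : Finset M} {φ : M → Z} {L a : ℝ}
    (hT : T.Nonempty) (hTN : T ⊆ N) (hN : N.card ≤ m) (hL : 0 ≤ L) (ha : 0 ≤ a)
    (hφ : ∀ s ∈ T, ∀ t ∈ T, dist (φ s) (φ t) ≤ L * dist s t) (g : M → M')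
    (hg : ∀ x ∈ N, ∀ y ∈ N, dist x y ≤ a * dist (g x) (g y)) :
    ∃ Φ : M → Z, (∀ t ∈ T, Φ t = φ t) ∧
      ∀ x ∈ N, ∀ y ∈ N, dist (Φ x) (Φ y) ≤ K * (a * L) * dist (g x) (g y) := by
  classical
  have hinj : Set.InjOn g (T : Set M) := by
    intro x hx y hy hxy
    have := hg x (hTN hx) y (hTN hy)
    rw [hxy, dist_self, mul_zero] at this
    exact dist_le_zero.1 this
  have : Nonempty M := ⟨hT.choose⟩
  let f := Function.invFunOn g (T : Set M)
  have hf : ∀ t ∈ T, f (g t) = t := fun t ht => hinj.leftInvOn_invFunOn ht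
  obtain ⟨Φ, h1, h2⟩ := h (T.image g) (N.image g) (φ ∘ f) (a * L) (hT.image g)
    (Finset.image_subset_image hTN) (Finset.card_image_le.trans hN) (by positivity) (by
      intro s' hs' t' ht'
      obtain ⟨s, hs, rfl⟩ := Finset.mem_image.1 hs'
      obtain ⟨t, ht, rfl⟩ := Finset.mem_image.1 ht'
      simp only [Function.comp, hf s hs, hf t ht]
      calc _ ≤ L * dist s t := hφ s hs t ht
        _ ≤ L * (a * dist (g s) (g t)) := by gcongr; exact hg s (hTN hs) t (hTN ht)
        _ = _ := by ring)
  refine ⟨Φ ∘ g, fun t ht => ?_, fun x hx y hy => ?_⟩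
  · simp [h1 (g t) (Finset.mem_image_of_mem g ht), hf t ht]
  · exact h2 _ (Finset.mem_image_of_mem g hx) _ (Finset.mem_image_of_mem g hy)

/-! ### From closed sets to finite sets -/

theorem edist_le_lipConst_mul {X Y : Type*} [MetricSpace X] [MetricSpace Y] (φ : X → Y)
    (x y : X) : edist (φ x) (φ y) ≤ lipConst φ * edist x y := by
  by_cases h0 : edist x y = 0
  · have : x = y := by simpa using h0
    simp [this]
  rw [← ENNReal.div_le_iff h0 (edist_ne_top x y)]
  refine le_sInf fun L hL => ?_
  rw [ENNReal.div_le_iff h0 (edist_ne_top x y)]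
  exact hL x y

theorem lipConst_le_of_dist_le {X Y : Type*} [MetricSpace X] [MetricSpace Y] (φ : X → Y) (C : ℝ)
    (hC : 0 ≤ C) (h : ∀ x y, dist (φ x) (φ y) ≤ C * dist x y) :
    lipConst φ ≤ ENNReal.ofReal C := by
  refine sInf_le fun x y => ?_
  rw [edist_dist, edist_dist, ← ENNReal.ofReal_mul hC]
  exact ENNReal.ofReal_le_ofReal (h x y)

/-- Adding `n` points to an arbitrary closed set costs no more, up to constants, than extending
from a finite set of nearly closest points. -/
theorem lipExtAdd_le_of_finExt {M Z : Type*} [MetricSpace M] [MetricSpace Z] [Nonempty Z]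
    {n : ℕ} {K : ℝ} (hK : 1 ≤ K) (h : FinExt M Z (2 * n) K) :
    lipExtAdd n M Z ≤ ENNReal.ofReal (2 * K + 3) := by
  classical
  refine sup_le ?_ ?_
  · rw [← ENNReal.ofReal_one]; exact ENNReal.ofReal_le_ofReal (by linarith)
  refine iSup_le fun S => iSup_le fun hS => iSup_le fun x => iSup_le fun hx => ?_
  refine sInf_le ⟨?_, fun φ hφ => ?_⟩
  · rw [← ENNReal.ofReal_one]; exact ENNReal.ofReal_le_ofReal (by linarith)
  let L := (lipConst φ).toReal
  have hL0 : 0 ≤ L := ENNReal.toReal_nonneg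
  have hLof : lipConst φ = ENNReal.ofReal L := (ENNReal.ofReal_toReal hφ.ne).symm
  have hLip : ∀ s t, dist (φ s) (φ t) ≤ L * dist s t := by
    intro s t
    have := edist_le_lipConst_mul φ s t
    rw [hLof, edist_dist, edist_dist, ← ENNReal.ofReal_mul hL0] at this
    exact (ENNReal.ofReal_le_ofReal_iff (by positivity)).1 this
  rcases S.eq_empty_or_nonempty with hSe | hSne
  · refine ⟨fun _ => Classical.arbitrary Z, fun s => absurd s.2 (by simp [hSe]), ?_⟩
    refine (lipConst_le_of_dist_le _ 0 le_rfl (by simp)).trans (by simp)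
  rw [hLof, ← ENNReal.ofReal_mul (by linarith)]
  -- Closedness makes the distance from `x i` to S positive, so a factor 2 leaves room for a point
  -- of S that nearly attains it.
  have hnear : ∀ i, ∃ s ∈ S, ∀ t ∈ S, dist (x i) s ≤ 2 * dist (x i) t := by
    intro i
    have hpos : 0 < Metric.infDist (x i) S :=
      (hS.notMem_iff_infDist_pos hSne).1 (hx i)
    obtain ⟨s, hs, hs'⟩ := (Metric.infDist_lt_iff hSne).1
      (show Metric.infDist (x i) S < 2 * Metric.infDist (x i) S by linarith)
    refine ⟨s, hs, fun t ht => hs'.le.trans ?_⟩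
    have := Metric.infDist_le_dist_of_mem (x := x i) ht
    linarith
  choose s hsS hs using hnear
  let φ' : M → Z := fun m => if hm : m ∈ S then φ ⟨⟨m, Or.inl hm⟩, hm⟩ else Classical.arbitrary Z
  have hφ'S : ∀ a ∈ S, ∀ b ∈ S, dist (φ' a) (φ' b) ≤ L * dist a b := by
    intro a ha b hb
    simp only [φ', ha, hb, dif_pos]
    exact hLip _ _
  have hmain : ∃ F : M → Z, (∀ a ∈ S, F a = φ' a) ∧ ∀ a ∈ S ∪ Set.range x, ∀ b ∈ S ∪ Set.range x,
      dist (F a) (F b) ≤ (2 * K + 3) * L * dist a b := by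
    -- For n = 0 the finite set of near points would be empty, which `FinExt` excludes.
    rcases isEmpty_or_nonempty (Fin n) with hn | hn
    · refine ⟨φ', fun _ _ => rfl, ?_⟩
      simp only [Set.range_eq_empty, Set.union_empty]
      intro a ha b hb
      refine (hφ'S a ha b hb).trans ?_
      gcongr
      nlinarith
    let T : Finset M := Finset.univ.image s
    let N : Finset M := T ∪ Finset.univ.image x
    have hTS : ∀ t ∈ T, t ∈ S := by
      intro t ht
      obtain ⟨i, -, rfl⟩ := Finset.mem_image.1 ht
      exact hsS i
    have hcard : N.card ≤ 2 * n := by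
      refine (Finset.card_union_le _ _).trans ?_
      have h1 : T.card ≤ n := by simpa using Finset.card_image_le (s := Finset.univ) (f := s)
      have h2 : (Finset.univ.image x).card ≤ n := by
        simpa using Finset.card_image_le (s := Finset.univ) (f := x)
      omega
    obtain ⟨Φ, hΦ1, hΦ2⟩ := h T N φ' L (Finset.univ_nonempty.image s) Finset.subset_union_left hcard
      hL0 fun a ha b hb => hφ'S a (hTS a ha) b (hTS b hb)
    have hcross : ∀ a ∈ S, ∀ i, dist (φ' a) (Φ (x i)) ≤ (2 * K + 3) * L * dist a (x i) := by
      intro a ha i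
      have h1 := hφ'S a ha (s i) (hsS i)
      have hsT : s i ∈ T := Finset.mem_image_of_mem s (Finset.mem_univ i)
      have h2 := hΦ2 (s i) (Finset.subset_union_left hsT) (x i)
        (Finset.subset_union_right (Finset.mem_image_of_mem x (Finset.mem_univ i)))
      rw [hΦ1 _ hsT] at h2
      have h3 := dist_triangle (φ' a) (φ' (s i)) (Φ (x i))
      have h4 := hs i a ha
      have h5 := dist_triangle a (x i) (s i)
      rw [dist_comm (s i) (x i)] at h2
      rw [dist_comm (x i) a] at h4
      -- Going through `s i` costs at most three times `dist a (x i)` on S and twice that distance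
      -- in the finite extension, whence 3 + 2K.
      calc _ ≤ L * dist a (s i) + K * L * dist (x i) (s i) := by linarith
        _ ≤ L * (dist a (x i) + 2 * dist a (x i)) + K * L * (2 * dist a (x i)) := by
            gcongr
            linarith
        _ = _ := by ring
    refine ⟨fun m => if m ∈ S then φ' m else Φ m, fun a ha => by simp [ha], ?_⟩
    rintro a (ha | ⟨i, rfl⟩) b (hb | ⟨j, rfl⟩)
    · simp only [ha, hb, if_true]
      refine (hφ'S a ha b hb).trans ?_
      gcongr
      nlinarith
    · simp only [ha, hx j, if_true, if_false]
      exact hcross a ha j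
    · simp only [hb, hx i, if_true, if_false]
      rw [dist_comm, dist_comm (x i)]
      exact hcross b hb i
    · simp only [hx i, hx j, if_false]
      refine (hΦ2 _ (Finset.subset_union_right (Finset.mem_image_of_mem x (Finset.mem_univ i))) _
        (Finset.subset_union_right (Finset.mem_image_of_mem x (Finset.mem_univ j)))).trans ?_
      gcongr
      linarith
  obtain ⟨F, hF1, hF2⟩ := hmain
  refine ⟨fun m => F m, fun a => ?_, ?_⟩
  · refine (hF1 _ a.2).trans ?_
    exact dif_pos (show (a : ↥(S ∪ Set.range x)).val ∈ S from a.2)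
  · refine lipConst_le_of_dist_le _ _ (by nlinarith) fun a b => ?_
    exact hF2 a a.2 b b.2

/-! ### Uniform measures on balls of a finite set -/

open MeasureTheory in
theorem intervalIntegrable_inv_mul_of_bounded {u : ℝ → ℝ} (hu : Measurable u)
    (hb : ∀ r, |u r| ≤ 1) {a b : ℝ} (ha : 0 < a) (hab : a ≤ b) :
    IntervalIntegrable (fun r => r⁻¹ * u r) volume a b := by
  rw [intervalIntegrable_iff_integrableOn_Ioc_of_le hab]
  refine Measure.integrableOn_of_bounded (M := a⁻¹) (by simp)
    (measurable_inv.mul hu).aestronglyMeasurable ?_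
  refine (ae_restrict_iff' measurableSet_Ioc).2 (Filter.Eventually.of_forall fun r hr => ?_)
  have hr0 : 0 < r := ha.trans hr.1
  rw [Real.norm_eq_abs, abs_mul, abs_of_pos (inv_pos.2 hr0)]
  calc r⁻¹ * |u r| ≤ a⁻¹ * 1 := by
        gcongr
        · exact hr.1.le
        · exact hb r
    _ = a⁻¹ := mul_one _

section BallAverages

variable {M : Type*} [MetricSpace M]

/-- The number of points of `T` in the closed ball of radius `r` around `x`. -/
noncomputable def ballCount (T : Finset M) (x : M) (r : ℝ) : ℝ :=
  ((T.filter fun t => dist x t ≤ r).card : ℝ)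

/-- The uniform probability weight on the points of `T` in the closed ball of radius `r`
around `x`. -/
noncomputable def ballWeight (T : Finset M) (x : M) (r : ℝ) (t : M) : ℝ :=
  open Classical in if dist x t ≤ r then (ballCount T x r)⁻¹ else 0

theorem ballCount_mono (T : Finset M) (x : M) : Monotone (ballCount T x) := by
  intro r s hrs
  unfold ballCount
  exact_mod_cast Finset.card_le_card
    (Finset.monotone_filter_right T fun t _ (ht : dist x t ≤ r) => ht.trans hrs)

theorem ballCount_le_card (T : Finset M) (x : M) (r : ℝ) : ballCount T x r ≤ T.card := by
  unfold ballCount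
  exact_mod_cast Finset.card_filter_le _ _

theorem one_le_ballCount {T : Finset M} {x t : M} {r : ℝ} (ht : t ∈ T) (h : dist x t ≤ r) :
    1 ≤ ballCount T x r := by
  unfold ballCount
  exact_mod_cast Finset.card_pos.2 ⟨t, Finset.mem_filter.2 ⟨ht, h⟩⟩

theorem ballCount_nonneg (T : Finset M) (x : M) (r : ℝ) : 0 ≤ ballCount T x r :=
  Nat.cast_nonneg _

theorem ballWeight_nonneg (T : Finset M) (x : M) (r : ℝ) (t : M) : 0 ≤ ballWeight T x r t := by
  unfold ballWeight
  split_ifs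
  · exact inv_nonneg.2 (ballCount_nonneg _ _ _)
  · exact le_rfl

theorem sum_ballWeight {T : Finset M} {x t : M} {r : ℝ} (ht : t ∈ T) (h : dist x t ≤ r) :
    ∑ s ∈ T, ballWeight T x r s = 1 := by
  classical
  have h1 := one_le_ballCount ht h
  have : ∑ s ∈ T, ballWeight T x r s
      = ∑ s ∈ T.filter (fun t => dist x t ≤ r), (ballCount T x r)⁻¹ := by
    rw [Finset.sum_filter]
    exact Finset.sum_congr rfl fun s _ => by unfold ballWeight; congr
  rw [this, Finset.sum_const, nsmul_eq_mul]
  exact mul_inv_cancel₀ (by change ballCount T x r ≠ 0; linarith)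

theorem ballWeight_le_one {T : Finset M} {x t : M} {r : ℝ} (ht : t ∈ T) :
    ballWeight T x r t ≤ 1 := by
  unfold ballWeight
  split_ifs with h
  · exact inv_le_one_of_one_le₀ (one_le_ballCount ht h)
  · exact zero_le_one

theorem measurable_ballWeight (T : Finset M) (x t : M) :
    Measurable fun r => ballWeight T x r t := by
  unfold ballWeight
  exact Measurable.ite measurableSet_Ici (ballCount_mono T x).measurable.inv measurable_const

variable {Z : Type*} [NormedAddCommGroup Z] [NormedSpace ℝ Z]

theorem norm_sum_ballWeight_smul_le {T : Finset M} {x t : M} {r D : ℝ} (ht : t ∈ T)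
    (h : dist x t ≤ r) {f : M → Z} (hf : ∀ s ∈ T, dist x s ≤ r → ‖f s‖ ≤ D) :
    ‖∑ s ∈ T, ballWeight T x r s • f s‖ ≤ D := by
  calc _ ≤ ∑ s ∈ T, ballWeight T x r s * D := by
        refine norm_sum_le_of_le _ fun s hs => ?_
        rw [norm_smul, Real.norm_of_nonneg (ballWeight_nonneg _ _ _ _)]
        by_cases hr : dist x s ≤ r
        · exact mul_le_mul_of_nonneg_left (hf s hs hr) (ballWeight_nonneg _ _ _ _)
        · simp [ballWeight, hr]
    _ = D := by rw [← Finset.sum_mul, sum_ballWeight ht h, one_mul]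

/-- The total variation of two probability weights is 2 minus twice their overlap. Each point within
r - δ of x lies in both balls, and both balls have at most as many points as the ball of radius r +
δ around x, so the overlap is at least the ratio of the two ball sizes. Then 1 - u ≤ -log u turns
the ratio into a difference that telescopes under integration. -/
theorem sum_abs_ballWeight_sub_le {T : Finset M} {x y t : M} {r δ : ℝ} (hxy : dist x y ≤ δ)
    (ht : t ∈ T) (h : dist x t ≤ r - δ) :
    ∑ s ∈ T, |ballWeight T x r s - ballWeight T y r s| ≤
      2 * (Real.log (ballCount T x (r + δ)) - Real.log (ballCount T x (r - δ))) := by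
  classical
  have hδ : 0 ≤ δ := dist_nonneg.trans hxy
  have hC := one_le_ballCount ht h
  have hD : 1 ≤ ballCount T x (r + δ) := hC.trans (ballCount_mono T x (by linarith))
  have hyt : dist y t ≤ r := by
    have := dist_triangle y x t
    rw [dist_comm y x] at this
    linarith
  have hBy : ballCount T y r ≤ ballCount T x (r + δ) := by
    unfold ballCount
    refine Nat.cast_le.2 (Finset.card_le_card fun s hs => ?_)
    rw [Finset.mem_filter] at hs ⊢
    exact ⟨hs.1, by have := dist_triangle x y s; linarith⟩
  have hmin : ballCount T x (r - δ) / ballCount T x (r + δ) ≤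
      ∑ s ∈ T, min (ballWeight T x r s) (ballWeight T y r s) := by
    calc ballCount T x (r - δ) / ballCount T x (r + δ)
        = ∑ s ∈ T.filter (fun t => dist x t ≤ r - δ), (ballCount T x (r + δ))⁻¹ := by
          rw [Finset.sum_const, nsmul_eq_mul, div_eq_mul_inv]; rfl
      _ = ∑ s ∈ T, if dist x s ≤ r - δ then (ballCount T x (r + δ))⁻¹ else 0 :=
          Finset.sum_filter _ _
      _ ≤ _ := by
          refine Finset.sum_le_sum fun s hs => ?_
          split_ifs with hxs
          · have h1 : dist x s ≤ r := by linarith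
            have h2 : dist y s ≤ r := by
              have := dist_triangle y x s
              rw [dist_comm y x] at this
              linarith
            refine le_min ?_ ?_
            · rw [ballWeight, if_pos h1]
              have := one_le_ballCount hs h1
              exact inv_anti₀ (by linarith) (ballCount_mono T x (by linarith))
            · rw [ballWeight, if_pos h2]
              have := one_le_ballCount hs h2
              exact inv_anti₀ (by linarith) hBy
          · exact le_min (ballWeight_nonneg _ _ _ _) (ballWeight_nonneg _ _ _ _)
  have hsum : ∑ s ∈ T, |ballWeight T x r s - ballWeight T y r s| =
      2 - 2 * ∑ s ∈ T, min (ballWeight T x r s) (ballWeight T y r s) := by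
    have e : ∀ s, |ballWeight T x r s - ballWeight T y r s| = ballWeight T x r s +
        ballWeight T y r s - 2 * min (ballWeight T x r s) (ballWeight T y r s) := by
      intro s
      rcases le_total (ballWeight T x r s) (ballWeight T y r s) with h | h
      · rw [abs_of_nonpos (by linarith), min_eq_left h]; ring
      · rw [abs_of_nonneg (by linarith), min_eq_right h]; ring
    simp only [e]
    rw [Finset.sum_sub_distrib, Finset.sum_add_distrib, sum_ballWeight ht (by linarith),
      sum_ballWeight ht hyt, ← Finset.mul_sum]
    norm_num
  have hlog := Real.log_le_sub_one_of_pos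
    (show 0 < ballCount T x (r - δ) / ballCount T x (r + δ) by positivity)
  rw [Real.log_div (by positivity) (by positivity)] at hlog
  linarith

theorem norm_sum_ballWeight_sub_smul_le {T : Finset M} {x y t : M} {r δ D : ℝ}
    (hxy : dist x y ≤ δ) (ht : t ∈ T) (h : dist x t ≤ r - δ) {f : M → Z} (hD : 0 ≤ D)
    (hf : ∀ s ∈ T, dist x s ≤ r + δ → ‖f s‖ ≤ D) :
    ‖∑ s ∈ T, ballWeight T x r s • f s - ∑ s ∈ T, ballWeight T y r s • f s‖ ≤
      D * (2 * (Real.log (ballCount T x (r + δ)) - Real.log (ballCount T x (r - δ)))) := by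
  have hδ : 0 ≤ δ := dist_nonneg.trans hxy
  rw [← Finset.sum_sub_distrib]
  simp only [← sub_smul]
  refine le_trans ?_ (mul_le_mul_of_nonneg_left (sum_abs_ballWeight_sub_le hxy ht h) hD)
  rw [Finset.mul_sum]
  refine norm_sum_le_of_le _ fun s hs => ?_
  rw [norm_smul, mul_comm, Real.norm_eq_abs]
  by_cases hr : dist x s ≤ r + δ
  · gcongr
    exact hf s hs hr
  · have h1 : ¬ dist x s ≤ r := fun h => hr (by linarith)
    have h2 : ¬ dist y s ≤ r := fun h => hr (by have := dist_triangle x y s; linarith)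
    simp [ballWeight, h1, h2]

/-- The two shifted integrals cancel except on windows of length 2δ at the endpoints; the one at a
is nonnegative and is dropped. -/
theorem integral_add_sub_integral_sub_le {g : ℝ → ℝ} (hg : Monotone g) {a b δ B : ℝ}
    (hδ : 0 ≤ δ) (h0 : 0 ≤ g (a - δ)) (hB : ∀ r, g r ≤ B) :
    ∫ r in a..b, (g (r + δ) - g (r - δ)) ≤ 2 * δ * B := by
  have hi : ∀ a b, IntervalIntegrable g MeasureTheory.volume a b := fun a b =>
    hg.intervalIntegrable
  have hp : Monotone fun r => g (r + δ) := fun r s h => hg (by linarith)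
  have hm : Monotone fun r => g (r - δ) := fun r s h => hg (by linarith)
  rw [intervalIntegral.integral_sub hp.intervalIntegrable hm.intervalIntegrable,
    intervalIntegral.integral_comp_add_right, intervalIntegral.integral_comp_sub_right,
    intervalIntegral.integral_interval_sub_interval_comm (hi _ _) (hi _ _) (hi _ _)]
  have h1 : 0 ≤ ∫ r in a - δ..a + δ, g r :=
    intervalIntegral.integral_nonneg (by linarith) fun r hr => h0.trans (hg hr.1)
  have h2 : ∫ r in b - δ..b + δ, g r ≤ ∫ r in b - δ..b + δ, B :=
    intervalIntegral.integral_mono (by linarith) (hi _ _) (by simp) fun r => hB r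
  rw [intervalIntegral.integral_const, smul_eq_mul] at h2
  have e1 := intervalIntegral.integral_symm (μ := MeasureTheory.volume) (f := g) (a - δ) (a + δ)
  have e2 := intervalIntegral.integral_symm (μ := MeasureTheory.volume) (f := g) (b - δ) (b + δ)
  linarith

end BallAverages

/-! ### Averaging over log-uniform radii -/

section LogLog

variable {M : Type*} [MetricSpace M] {Z : Type*} [NormedAddCommGroup Z] [NormedSpace ℝ Z]

/-- Averages of `φ` over the balls around `x`, averaged over radii between `2 A` and `2 R A`. -/
noncomputable def ballAverage (T : Finset M) (R A : ℝ) (x : M) (φ : M → Z) : Z :=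
  (Real.log R)⁻¹ • ∫ r in (2 * A)..(2 * R * A), ∑ t ∈ T, (r⁻¹ * ballWeight T x r t) • φ t

theorem intervalIntegrable_sum_ballWeight (T : Finset M) (x : M) (φ : M → Z) {a b : ℝ}
    (ha : 0 < a) (hab : a ≤ b) :
    IntervalIntegrable (fun r => ∑ t ∈ T, (r⁻¹ * ballWeight T x r t) • φ t)
      MeasureTheory.volume a b := by
  have h : ∀ t ∈ T, IntervalIntegrable (fun r => (r⁻¹ * ballWeight T x r t) • φ t)
      MeasureTheory.volume a b := by
    intro t ht
    have := intervalIntegrable_inv_mul_of_bounded (measurable_ballWeight T x t)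
      (fun r => by
        rw [abs_of_nonneg (ballWeight_nonneg _ _ _ _)]; exact ballWeight_le_one ht) ha hab
    rw [intervalIntegrable_iff] at this ⊢
    exact this.smul_const (φ t)
  have e : (fun r => ∑ t ∈ T, (r⁻¹ * ballWeight T x r t) • φ t)
      = ∑ t ∈ T, fun r => (r⁻¹ * ballWeight T x r t) • φ t := by
    ext r; simp
  rw [e]
  exact IntervalIntegrable.sum T h

/-- The average has total mass one: radii start at 2A, so every ball contains t, and the integral of
1/r from 2A to 2RA is log R. -/
theorem ballAverage_sub_const [CompleteSpace Z] {T : Finset M} {R A : ℝ} {x t : M} (φ : M → Z)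
    (c : Z) (hR : 2 ≤ R) (hA : 0 < A) (ht : t ∈ T) (hxt : dist x t ≤ A) :
    ballAverage T R A x φ - c = ballAverage T R A x (fun s => φ s - c) := by
  have hab : 2 * A ≤ 2 * R * A := by nlinarith
  have hlog : 0 < Real.log R := Real.log_pos (by linarith)
  have h1 : ∫ r in (2 * A)..(2 * R * A), ∑ t ∈ T, (r⁻¹ * ballWeight T x r t) • c
      = Real.log R • c := by
    have : ∫ r in (2 * A)..(2 * R * A), ∑ t ∈ T, (r⁻¹ * ballWeight T x r t) • c
        = ∫ r in (2 * A)..(2 * R * A), r⁻¹ • c := by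
      refine intervalIntegral.integral_congr fun r hr => ?_
      rw [Set.uIcc_of_le hab] at hr
      simp only [← Finset.sum_smul, ← Finset.mul_sum]
      rw [sum_ballWeight ht (by linarith [hr.1]), mul_one]
    rw [this, intervalIntegral.integral_smul_const, integral_inv_of_pos (by linarith) (by nlinarith)]
    congr 2
    field_simp
  have h2 : ballAverage T R A x (fun s => φ s - c) = (Real.log R)⁻¹ •
      ((∫ r in (2 * A)..(2 * R * A), ∑ t ∈ T, (r⁻¹ * ballWeight T x r t) • φ t) -
        ∫ r in (2 * A)..(2 * R * A), ∑ t ∈ T, (r⁻¹ * ballWeight T x r t) • c) := by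
    rw [← intervalIntegral.integral_sub (intervalIntegrable_sum_ballWeight T x φ (by linarith) hab)
      (intervalIntegrable_sum_ballWeight T x (fun _ => c) (by linarith) hab)]
    simp only [ballAverage, smul_sub, Finset.sum_sub_distrib]
  rw [h2, h1, smul_sub, inv_smul_smul₀ hlog.ne']
  rfl

theorem norm_inv_smul_sum_ballWeight_le {T : Finset M} {x t : M} {r L : ℝ} (ht : t ∈ T)
    (h : dist x t ≤ r) (hr : 0 < r) {f : M → Z}
    (hf : ∀ s ∈ T, dist x s ≤ r → ‖f s‖ ≤ 2 * r * L) :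
    ‖∑ s ∈ T, (r⁻¹ * ballWeight T x r s) • f s‖ ≤ 2 * L := by
  have := norm_sum_ballWeight_smul_le ht h hf
  simp only [mul_smul, ← Finset.smul_sum]
  rw [norm_smul, Real.norm_of_nonneg (by positivity)]
  calc _ ≤ r⁻¹ * (2 * r * L) := by gcongr
    _ = 2 * L := by field_simp

theorem norm_ballAverage_sub_le [CompleteSpace Z] {T : Finset M} {R A L : ℝ} {x t : M}
    {φ : M → Z} (hR : 2 ≤ R) (hA : 0 < A) (hL : 0 ≤ L) (ht : t ∈ T) (hxt : dist x t ≤ A)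
    (hφ : ∀ s ∈ T, ∀ t ∈ T, dist (φ s) (φ t) ≤ L * dist s t) :
    ‖ballAverage T R A x φ - φ t‖ ≤ 8 * R * L * A := by
  have hab : 2 * A ≤ 2 * R * A := by nlinarith
  have hlog : 1 / 2 ≤ Real.log R :=
    (by linarith [Real.log_two_gt_d9] : 1 / 2 ≤ Real.log 2).trans
      (Real.log_le_log (by norm_num) hR)
  rw [ballAverage_sub_const φ (φ t) hR hA ht hxt, ballAverage, norm_smul,
    Real.norm_of_nonneg (by positivity)]
  have h1 : ‖∫ r in (2 * A)..(2 * R * A), ∑ s ∈ T, (r⁻¹ * ballWeight T x r s) • (φ s - φ t)‖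
      ≤ 2 * L * |2 * R * A - 2 * A| := by
    refine intervalIntegral.norm_integral_le_of_norm_le_const fun r hr => ?_
    rw [Set.uIoc_of_le hab] at hr
    refine norm_inv_smul_sum_ballWeight_le ht (by linarith [hr.1]) (by linarith [hr.1])
      fun s hs hxs => ?_
    rw [← dist_eq_norm]
    refine (hφ s hs t ht).trans ?_
    have := dist_triangle s x t
    rw [dist_comm s x] at this
    rw [mul_comm _ L]
    gcongr
    linarith [hr.1]
  rw [abs_of_nonneg (by linarith)] at h1
  calc _ ≤ (1 / 2 : ℝ)⁻¹ * (2 * L * (2 * R * A - 2 * A)) := by gcongr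
    _ ≤ _ := by
      have : 0 ≤ L * A := by positivity
      norm_num
      nlinarith

/-- The radius intervals [2A, 2RA] and [2B, 2RB] share [2B, 2RA]. The unshared ends contribute 4Lδ
and 4RLδ. On the shared part the oscillation bound 2rL cancels the density 1/r, leaving 4L times a
telescoping difference of log ball sizes, at most 8Lδ log |T|. -/
theorem norm_ballAverage_sub_ballAverage_le [CompleteSpace Z] {T : Finset M} {R A B δ L : ℝ} {x y t : M}
    {φ : M → Z} (hR : 2 ≤ R) (hAB : A ≤ B) (hBA : B ≤ A + δ) (hδ : 4 * δ < A) (hL : 0 ≤ L)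
    (hxy : dist x y ≤ δ) (ht : t ∈ T) (hxt : dist x t ≤ A) {s : M} (hs : s ∈ T)
    (hys : dist y s ≤ B) (hφ : ∀ s ∈ T, ∀ t ∈ T, dist (φ s) (φ t) ≤ L * dist s t) :
    ‖ballAverage T R A x φ - ballAverage T R B y φ‖ ≤
      (Real.log R)⁻¹ * (L * δ * (4 + 8 * Real.log T.card + 4 * R)) := by
  have hδ0 : 0 ≤ δ := dist_nonneg.trans hxy
  have hA : 0 < A := by linarith
  have hlog : 0 < Real.log R := Real.log_pos (by linarith)
  have e0 : ballAverage T R A x φ - ballAverage T R B y φ =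
      (ballAverage T R A x φ - φ t) - (ballAverage T R B y φ - φ t) := by abel
  rw [e0, ballAverage_sub_const φ (φ t) hR hA ht hxt,
    ballAverage_sub_const φ (φ t) hR (by linarith) hs hys]
  unfold ballAverage
  rw [← smul_sub, norm_smul, Real.norm_of_nonneg (by positivity)]
  gcongr
  have h12 : 2 * A ≤ 2 * B := by linarith
  have h23 : 2 * B ≤ 2 * R * A := by nlinarith
  have h34 : 2 * R * A ≤ 2 * R * B := by gcongr
  set f : M → Z := fun s => φ s - φ t
  have hI := fun (x : M) (a b : ℝ) (ha : 0 < a) (hab : a ≤ b) =>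
    intervalIntegrable_sum_ballWeight T x f ha hab
  have hfs : ∀ r, 2 * A ≤ r → ∀ s ∈ T, dist x s ≤ r + δ → ‖f s‖ ≤ 2 * r * L := by
    intro r hr s hs hxs
    rw [← dist_eq_norm]
    refine (hφ s hs t ht).trans ?_
    have := dist_triangle s x t
    rw [dist_comm s x] at this
    rw [mul_comm _ L]
    gcongr
    linarith
  rw [← intervalIntegral.integral_add_adjacent_intervals (hI x _ _ (by linarith) h12)
    (hI x _ _ (by linarith) h23),
    ← intervalIntegral.integral_add_adjacent_intervals (hI y _ _ (by linarith) h23)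
    (hI y _ _ (by linarith) h34)]
  have b1 : ‖∫ r in (2 * A)..(2 * B), ∑ s ∈ T, (r⁻¹ * ballWeight T x r s) • f s‖
      ≤ 2 * L * |2 * B - 2 * A| := by
    refine intervalIntegral.norm_integral_le_of_norm_le_const fun r hr => ?_
    rw [Set.uIoc_of_le h12] at hr
    exact norm_inv_smul_sum_ballWeight_le ht (by linarith [hr.1]) (by linarith [hr.1])
      fun s hs hxs => hfs r hr.1.le s hs (by linarith)
  have b3 : ‖∫ r in (2 * R * A)..(2 * R * B), ∑ s ∈ T, (r⁻¹ * ballWeight T y r s) • f s‖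
      ≤ 2 * L * |2 * R * B - 2 * R * A| := by
    refine intervalIntegral.norm_integral_le_of_norm_le_const fun r hr => ?_
    rw [Set.uIoc_of_le h34] at hr
    exact norm_inv_smul_sum_ballWeight_le hs (by linarith [hr.1]) (by linarith [hr.1])
      fun s hs hys => hfs r (by linarith [hr.1]) s hs (by
        have := dist_triangle x y s; linarith)
  rw [abs_of_nonneg (by linarith)] at b1 b3
  -- The truncation at 1 makes g monotone and nonnegative at all radii; on the range of integration
  -- the balls are nonempty and it has no effect.
  let g : ℝ → ℝ := fun r => Real.log (max 1 (ballCount T x r))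
  have hg : Monotone g := fun r s hrs => Real.log_le_log (by positivity)
    (max_le_max le_rfl (ballCount_mono T x hrs))
  have hgB : ∀ r, g r ≤ Real.log T.card := fun r => Real.log_le_log (by positivity)
    (max_le (by exact_mod_cast Finset.card_pos.2 ⟨t, ht⟩) (ballCount_le_card T x r))
  have hg0 : ∀ r, 0 ≤ g r := fun r => Real.log_nonneg (le_max_left _ _)
  have hp : Monotone fun r => g (r + δ) := fun r s h => hg (by linarith)
  have hm : Monotone fun r => g (r - δ) := fun r s h => hg (by linarith)
  have b2 : ‖∫ r in (2 * B)..(2 * R * A), (∑ s ∈ T, (r⁻¹ * ballWeight T x r s) • f s -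
      ∑ s ∈ T, (r⁻¹ * ballWeight T y r s) • f s)‖ ≤
      ∫ r in (2 * B)..(2 * R * A), 4 * L * (g (r + δ) - g (r - δ)) := by
    refine intervalIntegral.norm_integral_le_of_norm_le h23
      (Filter.Eventually.of_forall fun r hr => ?_)
      ((hp.intervalIntegrable.sub hm.intervalIntegrable).const_mul _)
    have hr1 := hr.1
    have hr0 : 0 < r := by linarith
    have hc1 := one_le_ballCount ht (show dist x t ≤ r - δ by linarith)
    have hc2 := one_le_ballCount ht (show dist x t ≤ r + δ by linarith)
    have := norm_sum_ballWeight_sub_smul_le hxy ht (show dist x t ≤ r - δ by linarith)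
      (by positivity) (hfs r (by linarith))
    simp only [mul_smul, ← Finset.smul_sum]
    rw [← smul_sub, norm_smul, Real.norm_of_nonneg (by positivity)]
    simp only [g, max_eq_right hc1, max_eq_right hc2]
    refine (mul_le_mul_of_nonneg_left this (by positivity : 0 ≤ r⁻¹)).trans_eq ?_
    field_simp; ring
  rw [intervalIntegral.integral_const_mul, intervalIntegral.integral_sub
    (hI x _ _ (by linarith) h23) (hI y _ _ (by linarith) h23)] at b2
  have b2' := integral_add_sub_integral_sub_le hg (a := 2 * B) (b := 2 * R * A) hδ0 (hg0 _) hgB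
  have b2'' := mul_le_mul_of_nonneg_left b2' (show 0 ≤ 4 * L by positivity)
  have hBδ : L * (B - A) ≤ L * δ := by gcongr; linarith
  have hRBδ : L * R * (B - A) ≤ L * R * δ := by gcongr; linarith
  set I1 := ∫ r in (2 * A)..(2 * B), ∑ s ∈ T, (r⁻¹ * ballWeight T x r s) • f s
  set I2 := ∫ r in (2 * B)..(2 * R * A), ∑ s ∈ T, (r⁻¹ * ballWeight T x r s) • f s
  set I3 := ∫ r in (2 * B)..(2 * R * A), ∑ s ∈ T, (r⁻¹ * ballWeight T y r s) • f s
  set I4 := ∫ r in (2 * R * A)..(2 * R * B), ∑ s ∈ T, (r⁻¹ * ballWeight T y r s) • f s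
  have hsplit : I1 + I2 - (I3 + I4) = I1 + (I2 - I3) - I4 := by abel
  rw [hsplit]
  have n1 := norm_sub_le (I1 + (I2 - I3)) I4
  have n2 := norm_add_le I1 (I2 - I3)
  linarith

/-- Averaging over balls of random logarithmically uniform radius. -/
theorem finExt_of_log_ratio (M : Type*) [MetricSpace M] (Z : Type*) [NormedAddCommGroup Z]
    [NormedSpace ℝ Z] [CompleteSpace Z] (m : ℕ) {R : ℝ} (hR : 2 ≤ R) :
    FinExt M Z m (100 * R + 8 * (Real.log m / Real.log R)) := by
  classical
  intro T N φ L hT hTN hN hL hφ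
  have hTne : (T : Set M).Nonempty := hT
  let A : M → ℝ := fun x => Metric.infDist x T
  have hA0 : ∀ x, 0 ≤ A x := fun x => Metric.infDist_nonneg
  have hnear : ∀ x, ∃ t ∈ T, dist x t = A x := by
    intro x
    obtain ⟨t, ht, h⟩ := T.finite_toSet.isCompact.exists_infDist_eq_dist hTne x
    exact ⟨t, ht, h.symm⟩
  have hAδ : ∀ x y, A x ≤ A y + dist x y := fun x y => Metric.infDist_le_infDist_add_dist
  let Φ : M → Z := fun x => if A x = 0 then φ x else ballAverage T R (A x) x φ
  have hΦ : ∀ x, ∀ t ∈ T, dist x t = A x → ‖Φ x - φ t‖ ≤ 8 * R * L * A x := by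
    intro x t ht hxt
    by_cases h : A x = 0
    · have : x = t := by rwa [h, dist_eq_zero] at hxt
      subst this
      simp [Φ, h]
    · simp only [Φ, h, if_false]
      exact norm_ballAverage_sub_le hR (lt_of_le_of_ne (hA0 x) (Ne.symm h)) hL ht hxt.le hφ
  have hlog : 1 / 2 ≤ Real.log R :=
    (by linarith [Real.log_two_gt_d9] : 1 / 2 ≤ Real.log 2).trans
      (Real.log_le_log (by norm_num) hR)
  have hTm : Real.log T.card ≤ Real.log m := Real.log_le_log
    (by exact_mod_cast Finset.card_pos.2 hT) (by exact_mod_cast (Finset.card_le_card hTN).trans hN)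
  have hm0 : 0 ≤ Real.log m := Real.log_natCast_nonneg m
  -- When the points are far apart relative to A, compare through nearest points of T: A x ≤ 4D and
  -- A y ≤ 5D with D = `dist x y`, so the nearest points are within 10D.
  have hfar : ∀ x y, A x ≤ 4 * dist x y →
      dist (Φ x) (Φ y) ≤ (100 * R + 8 * (Real.log m / Real.log R)) * L * dist x y := by
    intro x y hxy
    obtain ⟨s, hs, hxs⟩ := hnear x
    obtain ⟨t, ht, hyt⟩ := hnear y
    have h1 := hΦ x s hs hxs
    have h2 := hΦ y t ht hyt
    have h3 := hφ s hs t ht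
    rw [← dist_eq_norm] at h1 h2
    have h4 := dist_triangle4 (Φ x) (φ s) (φ t) (Φ y)
    rw [dist_comm (φ t) (Φ y)] at h4
    have h5 := dist_triangle4 s x y t
    rw [dist_comm s x, hxs, hyt] at h5
    have h6 := hAδ y x
    rw [dist_comm y x] at h6
    have h7 : 0 ≤ 8 * (Real.log m / Real.log R) * L * dist x y := by positivity
    calc _ ≤ 8 * R * L * A x + L * dist s t + 8 * R * L * A y := by linarith
      _ ≤ 8 * R * L * (4 * dist x y) + L * (10 * dist x y) + 8 * R * L * (5 * dist x y) := by
          gcongr <;> linarith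
      _ ≤ (100 * R) * L * dist x y := by
          have : 0 ≤ L * dist x y := by positivity
          nlinarith
      _ ≤ _ := by nlinarith
  have hclose : ∀ x y, A x ≤ A y → 4 * dist x y < A x →
      dist (Φ x) (Φ y) ≤ (100 * R + 8 * (Real.log m / Real.log R)) * L * dist x y := by
    intro x y hAB hxy
    obtain ⟨s, hs, hxs⟩ := hnear x
    obtain ⟨t, ht, hyt⟩ := hnear y
    have hx0 : A x ≠ 0 := by
      have := dist_nonneg (x := x) (y := y)
      linarith
    have hy0 : A y ≠ 0 := by
      have := hA0 x
      exact fun h => hx0 (by linarith)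
    have hyx := hAδ y x
    rw [dist_comm y x] at hyx
    rw [dist_eq_norm]
    simp only [Φ, hx0, hy0, if_false]
    refine (norm_ballAverage_sub_ballAverage_le hR hAB hyx hxy hL le_rfl hs hxs.le ht hyt.le
      hφ).trans ?_
    have hi : (Real.log R)⁻¹ ≤ 2 := by
      rw [inv_le_comm₀ (by positivity) (by norm_num)]; linarith
    have hLd : 0 ≤ L * dist x y := by positivity
    calc _ = (L * dist x y) * ((Real.log R)⁻¹ * (4 + 4 * R) +
            8 * (Real.log T.card / Real.log R)) := by ring
      _ ≤ (L * dist x y) * (2 * (4 + 4 * R) + 8 * (Real.log m / Real.log R)) := by gcongr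
      _ ≤ (L * dist x y) * (100 * R + 8 * (Real.log m / Real.log R)) :=
          mul_le_mul_of_nonneg_left (by linarith) hLd
      _ = _ := by ring
  refine ⟨Φ, fun t ht => ?_, fun x _ y _ => ?_⟩
  · have : A t = 0 := Metric.infDist_zero_of_mem (by exact_mod_cast ht)
    simp [Φ, this]
  · rcases le_or_gt (A x) (4 * dist x y) with h | h
    · exact hfar x y h
    rcases le_or_gt (A y) (4 * dist x y) with h' | h'
    · rw [dist_comm, dist_comm x]
      exact hfar y x (by rwa [dist_comm y x])
    rcases le_total (A x) (A y) with h'' | h''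
    · exact hclose x y h'' h
    · rw [dist_comm, dist_comm x]
      exact hclose y x h'' (by rwa [dist_comm y x])

end LogLog

/-! ### Kirszbraun's theorem by convex duality -/

open scoped InnerProductSpace in
theorem sum_mul_mul_norm_sub_sq {ι G : Type*} [NormedAddCommGroup G] [InnerProductSpace ℝ G]
    [Fintype ι] {c : ι → ℝ} (hc : ∑ i, c i = 1) (z : ι → G) :
    ∑ i, ∑ j, c i * c j * ‖z i - z j‖ ^ 2 =
      2 * (∑ i, c i * ‖z i‖ ^ 2 - ‖∑ i, c i • z i‖ ^ 2) := by
  have e1 : ‖∑ i, c i • z i‖ ^ 2 = ∑ i, ∑ j, c i * c j * ⟪z i, z j⟫_ℝ := by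
    rw [← real_inner_self_eq_norm_sq, sum_inner]
    refine Finset.sum_congr rfl fun i _ => ?_
    rw [inner_sum]
    refine Finset.sum_congr rfl fun j _ => ?_
    rw [real_inner_smul_left, real_inner_smul_right]; ring
  have e2 : ∑ i, ∑ j, c i * c j * ‖z i‖ ^ 2 = ∑ i, c i * ‖z i‖ ^ 2 := by
    refine Finset.sum_congr rfl fun i _ => ?_
    rw [← Finset.sum_mul, ← Finset.mul_sum, hc, mul_one]
  have e3 : ∑ i, ∑ j, c i * c j * ‖z j‖ ^ 2 = ∑ i, c i * ‖z i‖ ^ 2 := by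
    rw [Finset.sum_comm, ← e2]
    exact Finset.sum_congr rfl fun i _ => Finset.sum_congr rfl fun j _ => by ring
  calc _ = ∑ i, ∑ j, (c i * c j * ‖z i‖ ^ 2 + c i * c j * ‖z j‖ ^ 2
          - 2 * (c i * c j * ⟪z i, z j⟫_ℝ)) := by
        refine Finset.sum_congr rfl fun i _ => Finset.sum_congr rfl fun j _ => ?_
        rw [norm_sub_sq_real]; ring
    _ = _ := by
        simp only [Finset.sum_sub_distrib, Finset.sum_add_distrib, ← Finset.mul_sum]
        rw [e2, e3, e1]; ring

-- Finding q amounts to minimising the largest value of ‖q - y i‖² - r i. The concave function D is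
-- the dual objective on the simplex; q is the barycentre at a maximiser, and the optimality
-- condition towards each vertex i gives ‖q - y i‖² - r i ≤ D c. Comparing the variances of the two
-- families shows D c ≤ 0.
open scoped InnerProductSpace in
theorem exists_dist_le_of_dist_le {ι E F : Type*} [NormedAddCommGroup E] [InnerProductSpace ℝ E]
    [NormedAddCommGroup F] [InnerProductSpace ℝ F] [Fintype ι] [Nonempty ι] (x : ι → E) (y : ι → F)
    (h : ∀ i j, dist (y i) (y j) ≤ dist (x i) (x j)) (p : E) :
    ∃ q : F, ∀ i, dist q (y i) ≤ dist p (x i) := by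
  classical
  let r : ι → ℝ := fun i => ‖p - x i‖ ^ 2
  let D : (ι → ℝ) → ℝ := fun c => ∑ i, c i * (‖y i‖ ^ 2 - r i) - ‖∑ i, c i • y i‖ ^ 2
  have hD : Continuous D := by fun_prop
  obtain ⟨c, hc, hmax⟩ := (isCompact_stdSimplex ℝ ι).exists_isMaxOn
    (⟨_, single_mem_stdSimplex ℝ (Classical.arbitrary ι)⟩ : (stdSimplex ℝ ι).Nonempty)
    hD.continuousOn
  let q := ∑ i, c i • y i
  have hsum : ∑ i, c i = 1 := hc.2
  have hDc : D c ≤ 0 := by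
    have h1 := sum_mul_mul_norm_sub_sq hsum y
    have h2 := sum_mul_mul_norm_sub_sq hsum fun i => p - x i
    have h3 : ∑ i, ∑ j, c i * c j * ‖y i - y j‖ ^ 2 ≤
        ∑ i, ∑ j, c i * c j * ‖(p - x i) - (p - x j)‖ ^ 2 := by
      refine Finset.sum_le_sum fun i _ => Finset.sum_le_sum fun j _ => ?_
      have := h i j
      rw [dist_eq_norm, dist_comm, dist_eq_norm] at this
      have e : (p - x i) - (p - x j) = x j - x i := by abel
      rw [e]
      have := hc.1 i
      have := hc.1 j
      gcongr
    have h4 : D c = ∑ i, c i * ‖y i‖ ^ 2 - ∑ i, c i * ‖p - x i‖ ^ 2 - ‖∑ i, c i • y i‖ ^ 2 := by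
      simp only [D, r, mul_sub, Finset.sum_sub_distrib]
    have := sq_nonneg ‖∑ i, c i • (p - x i)‖
    linarith
  refine ⟨q, fun i => ?_⟩
  -- Move the maximiser a fraction s towards vertex i and expand D; the linear gain cannot exceed
  -- the quadratic loss.
  have hopt : ∀ s : ℝ, 0 ≤ s → s ≤ 1 →
      s * ((‖y i‖ ^ 2 - r i) - ∑ j, c j * (‖y j‖ ^ 2 - r j) - 2 * ⟪q, y i - q⟫_ℝ)
        ≤ s ^ 2 * ‖y i - q‖ ^ 2 := by
    intro s hs0 hs1
    have hmem : (1 - s) • c + s • (Pi.single i 1 : ι → ℝ) ∈ stdSimplex ℝ ι :=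
      (convex_stdSimplex ℝ ι) hc (single_mem_stdSimplex ℝ i) (by linarith) hs0 (by ring)
    have hle : D ((1 - s) • c + s • (Pi.single i 1 : ι → ℝ)) ≤ D c := hmax hmem
    have e1 : ∑ j, ((1 - s) • c + s • (Pi.single i 1 : ι → ℝ)) j • y j = q + s • (y i - q) := by
      simp only [Pi.add_apply, Pi.smul_apply, add_smul, Finset.sum_add_distrib, smul_eq_mul,
        mul_smul, ← Finset.smul_sum, Pi.single_apply, ite_smul, one_smul, zero_smul,
        Finset.sum_ite_eq', Finset.mem_univ, if_true]
      change (1 - s) • q + s • y i = _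
      rw [sub_smul, one_smul, smul_sub]; abel
    have e2 : ∑ j, ((1 - s) • c + s • (Pi.single i 1 : ι → ℝ)) j * (‖y j‖ ^ 2 - r j)
        = (1 - s) * ∑ j, c j * (‖y j‖ ^ 2 - r j) + s * (‖y i‖ ^ 2 - r i) := by
      simp only [Pi.add_apply, Pi.smul_apply, add_mul, Finset.sum_add_distrib, smul_eq_mul,
        mul_assoc, ← Finset.mul_sum, Pi.single_apply, ite_mul, one_mul, zero_mul,
        Finset.sum_ite_eq', Finset.mem_univ, if_true]
    have e3 : ‖q + s • (y i - q)‖ ^ 2 =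
        ‖q‖ ^ 2 + 2 * s * ⟪q, y i - q⟫_ℝ + s ^ 2 * ‖y i - q‖ ^ 2 := by
      rw [norm_add_sq_real, real_inner_smul_right, norm_smul, mul_pow, Real.norm_eq_abs, sq_abs]
      ring
    simp only [D] at hle
    rw [e1, e2, e3] at hle
    change _ ≤ _ - ‖q‖ ^ 2 at hle
    linarith
  set α := (‖y i‖ ^ 2 - r i) - ∑ j, c j * (‖y j‖ ^ 2 - r j) - 2 * ⟪q, y i - q⟫_ℝ with hα
  have hα0 : α ≤ 0 := by
    by_contra hpos
    push Not at hpos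
    set β := ‖y i - q‖ ^ 2
    have hβ : 0 ≤ β := sq_nonneg _
    -- This s lies in [0, 1] even when β = 0, and is small enough that α ≤ sβ is absurd for α > 0.
    have := hopt (α / (α + β + β)) (by positivity) (by rw [div_le_one (by positivity)]; linarith)
    have h2 : α / (α + β + β) * α ≤ α / (α + β + β) * (α / (α + β + β) * β) := by
      calc _ ≤ _ := this
        _ = _ := by ring
    have h3 := le_of_mul_le_mul_left h2 (by positivity)
    rw [div_mul_eq_mul_div, le_div_iff₀ (by positivity)] at h3
    nlinarith
  have hfin : ‖q - y i‖ ^ 2 ≤ r i := by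
    have e : ‖q - y i‖ ^ 2 = ‖y i‖ ^ 2 - 2 * ⟪q, y i - q⟫_ℝ - ‖q‖ ^ 2 := by
      rw [norm_sub_sq_real, inner_sub_right, real_inner_self_eq_norm_sq]; ring
    have hDc' : ∑ j, c j * (‖y j‖ ^ 2 - r j) - ‖q‖ ^ 2 ≤ 0 := hDc
    linarith
  rw [dist_eq_norm, dist_eq_norm]
  exact (sq_le_sq₀ (norm_nonneg _) (norm_nonneg _)).1 hfin

/-- Kirszbraun's theorem for finite sets. -/
theorem finExt_inner (E F : Type*) [NormedAddCommGroup E] [InnerProductSpace ℝ E]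
    [NormedAddCommGroup F] [InnerProductSpace ℝ F] (m : ℕ) : FinExt E F m 1 := by
  classical
  intro T N φ L hT hTN _ hL hφ
  suffices H : ∀ P : Finset E, ∃ Φ : E → F, (∀ t ∈ T, Φ t = φ t) ∧
      ∀ x ∈ T ∪ P, ∀ y ∈ T ∪ P, dist (Φ x) (Φ y) ≤ 1 * L * dist x y by
    obtain ⟨Φ, h1, h2⟩ := H N
    rw [Finset.union_eq_right.2 hTN] at h2
    exact ⟨Φ, h1, h2⟩
  intro P
  induction P using Finset.induction_on with
  | empty => exact ⟨φ, fun _ _ => rfl, by simpa using hφ⟩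
  | insert p P hp ih =>
    obtain ⟨Φ, h1, h2⟩ := ih
    by_cases hpT : p ∈ T ∪ P
    · refine ⟨Φ, h1, ?_⟩
      rwa [Finset.union_insert, Finset.insert_eq_of_mem hpT]
    have : Nonempty (T ∪ P : Finset E) := ⟨⟨_, Finset.subset_union_left hT.choose_spec⟩⟩
    -- Dilating the source by L turns an L-Lipschitz map into a 1-Lipschitz one, also when L = 0.
    obtain ⟨q, hq⟩ := exists_dist_le_of_dist_le (fun i : (T ∪ P : Finset E) => L • (i : E))
      (fun i : (T ∪ P : Finset E) => Φ i) (fun i j => by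
        rw [dist_smul₀, Real.norm_of_nonneg hL]
        simpa using h2 i i.2 j j.2) (L • p)
    have hq' : ∀ x ∈ T ∪ P, dist q (Φ x) ≤ 1 * L * dist p x := by
      intro x hx
      have := hq ⟨x, hx⟩
      rwa [dist_smul₀, Real.norm_of_nonneg hL, ← one_mul L] at this
    refine ⟨Function.update Φ p q, fun t ht => ?_, ?_⟩
    · rw [Function.update_of_ne, h1 t ht]
      rintro rfl
      exact hpT (Finset.subset_union_left ht)
    · have hne : ∀ x ∈ T ∪ P, x ≠ p := fun x hx h => hpT (h ▸ hx)
      rw [Finset.union_insert]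
      intro x hx y hy
      rcases Finset.mem_insert.1 hx with hx | hx <;> rcases Finset.mem_insert.1 hy with hy | hy
      · simp [hx, hy]
      · rw [hx, Function.update_self, Function.update_of_ne (hne y hy)]
        exact hq' y hy
      · rw [hy, Function.update_self, Function.update_of_ne (hne x hx), dist_comm, dist_comm x]
        exact hq' x hx
      · rw [Function.update_of_ne (hne x hx), Function.update_of_ne (hne y hy)]
        exact h2 x hx y hy

/-! ### Random signs and the Johnson–Lindenstrauss lemma -/

section Signs

/-- The sign `1` or `-1` encoded by a Boolean. -/
def boolSign (b : Bool) : ℝ := if b then 1 else -1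

theorem sum_boolSign_cons (D : ℕ) (c : Fin (D + 1) → ℝ) (f : ℝ → ℝ) :
    ∑ ε : Fin (D + 1) → Bool, f (∑ k, boolSign (ε k) * c k) =
      ∑ ε : Fin D → Bool, (f (c 0 + ∑ k, boolSign (ε k) * c k.succ) +
        f (-c 0 + ∑ k, boolSign (ε k) * c k.succ)) := by
  rw [← (Fin.consEquiv fun _ : Fin (D + 1) => Bool).sum_comp, Fintype.sum_prod_type]
  simp only [Fintype.sum_bool, Fin.consEquiv_apply, Fin.sum_univ_succ, Fin.cons_zero,
    Fin.cons_succ]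
  rw [← Finset.sum_add_distrib]
  simp [boolSign]

theorem sum_boolSign_sq (D : ℕ) (c : Fin D → ℝ) :
    ∑ ε : Fin D → Bool, (∑ k, boolSign (ε k) * c k) ^ 2 = 2 ^ D * ∑ k, c k ^ 2 := by
  induction D with
  | zero => simp
  | succ D ih =>
    rw [sum_boolSign_cons D c (fun x => x ^ 2)]
    have e : ∀ ε : Fin D → Bool, (c 0 + ∑ k, boolSign (ε k) * c k.succ) ^ 2 +
        (-c 0 + ∑ k, boolSign (ε k) * c k.succ) ^ 2 =
        2 * c 0 ^ 2 + 2 * (∑ k, boolSign (ε k) * c k.succ) ^ 2 := fun ε => by ring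
    simp only [e]
    rw [Finset.sum_add_distrib, ← Finset.mul_sum, ← Finset.mul_sum, ih (fun k => c k.succ), Fin.sum_univ_succ]
    simp
    ring

theorem sum_boolSign_pow_four_le (D : ℕ) (c : Fin D → ℝ) :
    ∑ ε : Fin D → Bool, (∑ k, boolSign (ε k) * c k) ^ 4 ≤ 2 ^ D * (3 * (∑ k, c k ^ 2) ^ 2) := by
  induction D with
  | zero => simp
  | succ D ih =>
    rw [sum_boolSign_cons D c (fun x => x ^ 4)]
    have e : ∀ ε : Fin D → Bool, (c 0 + ∑ k, boolSign (ε k) * c k.succ) ^ 4 +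
        (-c 0 + ∑ k, boolSign (ε k) * c k.succ) ^ 4 =
        2 * c 0 ^ 4 + 12 * c 0 ^ 2 * (∑ k, boolSign (ε k) * c k.succ) ^ 2 +
          2 * (∑ k, boolSign (ε k) * c k.succ) ^ 4 := fun ε => by ring
    simp only [e]
    rw [Finset.sum_add_distrib, Finset.sum_add_distrib, ← Finset.mul_sum, ← Finset.mul_sum,
      ← Finset.mul_sum, sum_boolSign_sq, Fin.sum_univ_succ]
    have h := ih fun k => c k.succ
    simp only [Finset.sum_const, Finset.card_univ, Fintype.card_pi, Fintype.card_bool,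
      Finset.prod_const, Fintype.card_fin, nsmul_eq_mul, Nat.cast_pow, Nat.cast_ofNat]
    have h4 : 0 ≤ (2 : ℝ) ^ D * c 0 ^ 4 := by positivity
    rw [pow_succ (2 : ℝ) D]
    nlinarith

/-- Induction over the signs with a free shift s: the first sign joins the shift, the remaining ones
replace κ by κ minus their variance, and averaging over the first sign uses cosh u ≤ exp (u²/2). -/
theorem sum_exp_boolSign_sq_le (D : ℕ) (c : Fin D → ℝ) (s κ : ℝ) (h : ∑ k, c k ^ 2 < κ) :
    ∑ ε : Fin D → Bool, Real.exp ((s + ∑ k, boolSign (ε k) * c k) ^ 2 / (2 * κ)) ≤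
      2 ^ D * Real.exp ((s ^ 2 + ∑ k, c k ^ 2) / (2 * (κ - ∑ k, c k ^ 2))) := by
  induction D generalizing s with
  | zero => simp
  | succ D ih =>
    rw [sum_boolSign_cons D c fun x => Real.exp ((s + x) ^ 2 / (2 * κ))]
    rw [Fin.sum_univ_succ] at h ⊢
    set Q := ∑ k : Fin D, c k.succ ^ 2 with hQ
    set b := c 0
    have hQ0 : 0 ≤ Q := Finset.sum_nonneg fun _ _ => sq_nonneg _
    have hb0 := sq_nonneg b
    have h1 := ih (fun k => c k.succ) (s + b) (by linarith)
    have h2 := ih (fun k => c k.succ) (s + -b) (by linarith)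
    rw [← hQ] at h1 h2
    simp only [add_assoc] at h1 h2 ⊢
    rw [Finset.sum_add_distrib]
    refine (add_le_add h1 h2).trans ?_
    set κ' := κ - Q with hκ'
    have hκ0 : 0 < κ' := by linarith
    have e1 : ((s + b) ^ 2 + Q) / (2 * κ') = (s ^ 2 + b ^ 2 + Q) / (2 * κ') + s * b / κ' := by
      field_simp; ring
    have e2 : ((s + -b) ^ 2 + Q) / (2 * κ') = (s ^ 2 + b ^ 2 + Q) / (2 * κ') + -(s * b / κ') := by
      field_simp; ring
    have h3 : Real.exp (s * b / κ') + Real.exp (-(s * b / κ')) ≤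
        2 * Real.exp ((s * b / κ') ^ 2 / 2) := by
      have := Real.cosh_le_exp_half_sq (s * b / κ')
      rw [Real.cosh_eq] at this
      linarith
    have h4 : (s ^ 2 + b ^ 2 + Q) / (2 * κ') + (s * b / κ') ^ 2 / 2 ≤
        (s ^ 2 + (b ^ 2 + Q)) / (2 * (κ - (b ^ 2 + Q))) := by
      have e : κ - (b ^ 2 + Q) = κ' - b ^ 2 := by rw [hκ']; ring
      rw [e]
      have hpos : 0 < κ' - b ^ 2 := by linarith
      rw [div_add_div _ _ (by positivity) (by positivity), div_le_div_iff₀ (by positivity)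
        (by positivity), ← sub_nonneg]
      have : (s ^ 2 + (b ^ 2 + Q)) * (2 * κ' * 2) - ((s ^ 2 + b ^ 2 + Q) * 2 +
          2 * κ' * (s * b / κ') ^ 2) * (2 * (κ' - b ^ 2)) =
          4 * b ^ 2 * (b ^ 2 + Q + s ^ 2 * b ^ 2 / κ') := by
        field_simp; ring
      rw [this]
      positivity
    rw [e1, e2, Real.exp_add, Real.exp_add]
    calc _ = 2 ^ D * Real.exp ((s ^ 2 + b ^ 2 + Q) / (2 * κ')) *
          (Real.exp (s * b / κ') + Real.exp (-(s * b / κ'))) := by ring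
      _ ≤ 2 ^ D * Real.exp ((s ^ 2 + b ^ 2 + Q) / (2 * κ')) *
          (2 * Real.exp ((s * b / κ') ^ 2 / 2)) := by gcongr
      _ = 2 ^ (D + 1) * Real.exp ((s ^ 2 + b ^ 2 + Q) / (2 * κ') + (s * b / κ') ^ 2 / 2) := by
          rw [Real.exp_add]; ring
      _ ≤ _ := by gcongr

theorem exp_neg_le_quadratic {u : ℝ} (hu : 0 ≤ u) : Real.exp (-u) ≤ 1 - u + u ^ 2 / 2 := by
  have h := Real.quadratic_le_exp_of_nonneg hu
  rw [Real.exp_neg, inv_le_iff_one_le_mul₀ (Real.exp_pos u)]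
  have h1 : 0 ≤ 1 - u + u ^ 2 / 2 := by nlinarith [sq_nonneg (u - 1)]
  nlinarith [mul_le_mul_of_nonneg_left h h1, sq_nonneg (u ^ 2)]

/-- With second moment 1 and fourth moment at most 3, the quadratic bound for exp (-u) at u = X²/3
gives 1 - 1/3 + 3/18 = 5/6. -/
theorem sum_exp_neg_boolSign_sq_le (D : ℕ) (c : Fin D → ℝ) (h : ∑ k, c k ^ 2 = 1) :
    ∑ ε : Fin D → Bool, Real.exp (-(∑ k, boolSign (ε k) * c k) ^ 2 / 3) ≤ 2 ^ D * (5 / 6) := by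
  have h2 := sum_boolSign_sq D c
  have h4 := sum_boolSign_pow_four_le D c
  rw [h] at h2 h4
  calc _ ≤ ∑ ε : Fin D → Bool, (1 - (∑ k, boolSign (ε k) * c k) ^ 2 / 3 +
          (∑ k, boolSign (ε k) * c k) ^ 4 / 18) := by
        refine Finset.sum_le_sum fun ε _ => ?_
        have := exp_neg_le_quadratic (u := (∑ k, boolSign (ε k) * c k) ^ 2 / 3) (by positivity)
        rw [neg_div]
        refine this.trans_eq ?_
        ring
    _ ≤ _ := by
        rw [Finset.sum_add_distrib, Finset.sum_sub_distrib, ← Finset.sum_div, ← Finset.sum_div, h2]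
        simp only [Finset.sum_const, Finset.card_univ, Fintype.card_pi, Fintype.card_bool,
          Finset.prod_const, Fintype.card_fin, nsmul_eq_mul, Nat.cast_pow, Nat.cast_ofNat]
        linarith

/-- A sign matrix which is bounded above and below on finitely many unit vectors. -/
theorem exists_sign_matrix {ι : Type*} (V : Finset ι) (D d : ℕ) (c : ι → Fin D → ℝ)
    (hc : ∀ v ∈ V, ∑ k, c v k ^ 2 = 1) (hd : 10 * Real.log (2 * V.card) < d) :
    ∃ ε : Fin d → Fin D → Bool, ∀ v ∈ V,
      (d : ℝ) / 5 ≤ ∑ i, (∑ k, boolSign (ε i k) * c v k) ^ 2 ∧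
      ∑ i, (∑ k, boolSign (ε i k) * c v k) ^ 2 ≤ 4 * d := by
  classical
  rcases V.eq_empty_or_nonempty with rfl | hV
  · exact ⟨fun _ _ => true, by simp⟩
  let Y : ι → (Fin d → Fin D → Bool) → ℝ := fun v ε => ∑ i, (∑ k, boolSign (ε i k) * c v k) ^ 2
  have hprod : ∀ (v : ι) (g : ℝ → ℝ), ∑ ε : Fin d → Fin D → Bool,
      ∏ i, g (∑ k, boolSign (ε i k) * c v k) =
      (∑ ε : Fin D → Bool, g (∑ k, boolSign (ε k) * c v k)) ^ d := by
    intro v g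
    have := Finset.prod_univ_sum (fun _ : Fin d => (Finset.univ : Finset (Fin D → Bool)))
      fun _ ε => g (∑ k, boolSign (ε k) * c v k)
    rw [Fintype.piFinset_univ] at this
    rw [← this]
    simp
  -- The exponent is positive exactly when Y v falls below d/5. Independence of the rows gives the
  -- mean bound exp (d/15) (5/6)^d, and 5/6 ≤ exp (-1/6).
  have hlow : ∀ v ∈ V, ∑ ε, Real.exp (d / 15 - Y v ε / 3) ≤
      (2 ^ D) ^ d * Real.exp (-(d / 10)) := by
    intro v hv
    have e : ∀ ε, Real.exp (d / 15 - Y v ε / 3) = Real.exp (d / 15) *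
        ∏ i, Real.exp (-(∑ k, boolSign (ε i k) * c v k) ^ 2 / 3) := by
      intro ε
      rw [← Real.exp_sum, ← Real.exp_add, ← Finset.sum_div, Finset.sum_neg_distrib]
      congr 1
      simp only [Y]
      ring
    simp only [e]
    rw [← Finset.mul_sum, hprod v fun x => Real.exp (-x ^ 2 / 3)]
    have h1 := sum_exp_neg_boolSign_sq_le D (c v) (hc v hv)
    have h2 : (5 / 6 : ℝ) ≤ Real.exp (-(1 / 6)) := by
      have := Real.add_one_le_exp (-(1 / 6) : ℝ); linarith
    calc _ ≤ Real.exp (d / 15) * (2 ^ D * Real.exp (-(1 / 6))) ^ d := by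
          gcongr
          exact h1.trans (by gcongr)
      _ = (2 ^ D) ^ d * Real.exp (-(d / 10)) := by
          rw [mul_pow, ← Real.exp_nat_mul, mul_left_comm, ← Real.exp_add]
          congr 2
          ring
  have hup : ∀ v ∈ V, ∑ ε, Real.exp (Y v ε / 4 - d) ≤
      (2 ^ D) ^ d * Real.exp (-(d / 10)) := by
    intro v hv
    have e : ∀ ε, Real.exp (Y v ε / 4 - d) = Real.exp (-d) *
        ∏ i, Real.exp ((0 + ∑ k, boolSign (ε i k) * c v k) ^ 2 / (2 * 2)) := by
      intro ε
      rw [← Real.exp_sum, ← Real.exp_add, ← Finset.sum_div]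
      congr 1
      simp only [Y, zero_add]
      ring
    simp only [e]
    rw [← Finset.mul_sum, hprod v fun x => Real.exp ((0 + x) ^ 2 / (2 * 2))]
    have h1 := sum_exp_boolSign_sq_le D (c v) 0 2 (by rw [hc v hv]; norm_num)
    rw [hc v hv] at h1
    calc _ ≤ Real.exp (-d) * (2 ^ D * Real.exp ((0 ^ 2 + 1) / (2 * (2 - 1)))) ^ d := by
          gcongr
      _ = (2 ^ D) ^ d * Real.exp (-(d / 2)) := by
          rw [mul_pow, ← Real.exp_nat_mul, mul_left_comm, ← Real.exp_add]
          congr 2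
          ring
      _ ≤ _ := by
          gcongr
          have : (0 : ℝ) ≤ d := Nat.cast_nonneg d
          linarith
  -- Union bound: the failure exponentials average to at most 2|V| exp (-d/10) < 1, so some sign
  -- matrix keeps every one of them below 1.
  have hlt : ∑ ε : Fin d → Fin D → Bool, ∑ v ∈ V,
      (Real.exp (d / 15 - Y v ε / 3) + Real.exp (Y v ε / 4 - d)) <
      ∑ ε : Fin d → Fin D → Bool, (1 : ℝ) := by
    rw [Finset.sum_comm]
    calc _ ≤ ∑ v ∈ V, 2 * ((2 ^ D : ℝ) ^ d * Real.exp (-(d / 10))) := by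
          refine Finset.sum_le_sum fun v hv => ?_
          rw [Finset.sum_add_distrib]
          linarith [hlow v hv, hup v hv]
      _ = (2 ^ D) ^ d * (2 * V.card * Real.exp (-(d / 10))) := by
          rw [Finset.sum_const, nsmul_eq_mul]; ring
      _ < (2 ^ D) ^ d * 1 := by
          gcongr
          have hpos : (0 : ℝ) < 2 * V.card := by
            have := hV.card_pos
            positivity
          rw [Real.exp_neg, ← div_eq_mul_inv, div_lt_one (Real.exp_pos _),
            ← Real.log_lt_iff_lt_exp hpos]
          linarith
      _ = _ := by simp
  obtain ⟨ε, -, hε⟩ := Finset.exists_lt_of_sum_lt hlt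
  refine ⟨ε, fun v hv => ?_⟩
  have hv1 := (Finset.single_le_sum (f := fun v =>
    Real.exp (d / 15 - Y v ε / 3) + Real.exp (Y v ε / 4 - d)) (fun _ _ => by positivity) hv).trans_lt
    hε
  have h1 : Real.exp (d / 15 - Y v ε / 3) < 1 := by
    have := Real.exp_pos (Y v ε / 4 - d); linarith
  have h2 : Real.exp (Y v ε / 4 - d) < 1 := by
    have := Real.exp_pos (d / 15 - Y v ε / 3); linarith
  rw [Real.exp_lt_one_iff] at h1 h2
  constructor
  · change _ ≤ Y v ε
    linarith
  · change Y v ε ≤ _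
    linarith

end Signs

/-- The Johnson–Lindenstrauss lemma, with absolute constant distortion. -/
theorem exists_dimension_reduction {E : Type*} [NormedAddCommGroup E] [InnerProductSpace ℝ E]
    (N : Finset E) {d : ℕ} (hd0 : 0 < d) (hd : 10 * Real.log (2 * N.card ^ 2) < d) :
    ∃ g : E → EuclideanSpace ℝ (Fin d), ∀ x ∈ N, ∀ y ∈ N,
      dist x y ≤ 3 * dist (g x) (g y) ∧ dist (g x) (g y) ≤ 2 * dist x y := by
  classical
  let W : Submodule ℝ E := Submodule.span ℝ (N : Set E)
  have : FiniteDimensional ℝ W := FiniteDimensional.span_finset ℝ N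
  let D := Module.finrank ℝ W
  let b := stdOrthonormalBasis ℝ W
  let a : E → Fin D → ℝ := fun x k => inner ℝ ((b k : W) : E) x
  have ha : ∀ x ∈ N, ∀ y ∈ N, ∑ k, (a x k - a y k) ^ 2 = dist x y ^ 2 := by
    intro x hx y hy
    let w : W := ⟨x - y, W.sub_mem (Submodule.subset_span hx) (Submodule.subset_span hy)⟩
    have h1 := b.sum_sq_norm_inner_right w
    rw [dist_eq_norm, show ‖x - y‖ = ‖w‖ from rfl, ← h1]
    refine Finset.sum_congr rfl fun k _ => ?_
    rw [Real.norm_eq_abs, sq_abs]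
    simp only [a, ← inner_sub_right]
    rfl
  obtain ⟨ε, hε⟩ := exists_sign_matrix ((N ×ˢ N).filter fun q => q.1 ≠ q.2) D d
    (fun q k => (a q.1 k - a q.2 k) / dist q.1 q.2) (by
      intro q hq
      rw [Finset.mem_filter, Finset.mem_product] at hq
      simp only [div_pow, ← Finset.sum_div]
      rw [ha _ hq.1.1 _ hq.1.2, div_self]
      have := dist_pos.2 hq.2
      positivity) (by
      refine lt_of_le_of_lt ?_ hd
      rcases Nat.eq_zero_or_pos (((N ×ˢ N).filter fun q => q.1 ≠ q.2).card) with h0 | h0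
      · rw [h0]
        simp only [Nat.cast_zero, mul_zero, Real.log_zero]
        have : (2 * N.card ^ 2 : ℝ) = ((2 * N.card ^ 2 : ℕ) : ℝ) := by push_cast; ring
        rw [this]
        have := Real.log_natCast_nonneg (2 * N.card ^ 2)
        positivity
      · gcongr
        have := Finset.card_filter_le (N ×ˢ N) fun q => q.1 ≠ q.2
        rw [Finset.card_product, ← sq] at this
        exact_mod_cast this)
  have hdpos : (0 : ℝ) < d := by exact_mod_cast hd0
  let g : E → EuclideanSpace ℝ (Fin d) := fun x =>
    WithLp.toLp 2 fun i => (∑ k, boolSign (ε i k) * a x k) / √d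
  refine ⟨g, fun x hx y hy => ?_⟩
  by_cases hxy : x = y
  · simp [hxy]
  have hpos := dist_pos.2 hxy
  obtain ⟨h1, h2⟩ := hε (x, y) (by simp [hx, hy, hxy])
  have hg : dist (g x) (g y) ^ 2 = dist x y ^ 2 / d *
      ∑ i, (∑ k, boolSign (ε i k) * ((a x k - a y k) / dist x y)) ^ 2 := by
    rw [EuclideanSpace.dist_eq, Real.sq_sqrt (Finset.sum_nonneg fun _ _ => sq_nonneg _),
      Finset.mul_sum]
    refine Finset.sum_congr rfl fun i _ => ?_
    simp only [g, Real.dist_eq, sq_abs]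
    have : ∑ k, boolSign (ε i k) * ((a x k - a y k) / dist x y) =
        (∑ k, boolSign (ε i k) * a x k - ∑ k, boolSign (ε i k) * a y k) / dist x y := by
      rw [← Finset.sum_sub_distrib, Finset.sum_div]
      exact Finset.sum_congr rfl fun k _ => by ring
    rw [this, ← sub_div, div_pow, div_pow, Real.sq_sqrt hdpos.le]
    field_simp
  have hk : 0 ≤ dist x y ^ 2 / d := by positivity
  have l1 := mul_le_mul_of_nonneg_left h1 hk
  have l2 := mul_le_mul_of_nonneg_left h2 hk
  rw [← hg] at l1 l2
  have e1 : dist x y ^ 2 / d * (d / 5) = dist x y ^ 2 / 5 := by field_simp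
  have e2 : dist x y ^ 2 / d * (4 * d) = 4 * dist x y ^ 2 := by field_simp
  rw [e1] at l1
  rw [e2] at l2
  constructor
  · refine abs_le_of_sq_le_sq' ?_ (by positivity) |>.2
    nlinarith [sq_nonneg (dist x y)]
  · refine abs_le_of_sq_le_sq' ?_ (by positivity) |>.2
    nlinarith

/-! ### Gaussian averages in finite dimension -/

section Gaussian

open MeasureTheory Real

/-- A nearest-point selection with finitely many values, so measurability and boundedness of the
averaged function come for free. -/
theorem exists_simpleFunc_nearest {V : Type*} [NormedAddCommGroup V] [MeasurableSpace V]
    [BorelSpace V] (T : Finset V) (hT : T.Nonempty) :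
    ∃ ν : SimpleFunc V V, ∀ z, ν z ∈ T ∧ ∀ t ∈ T, dist z (ν z) ≤ dist z t := by
  obtain ⟨t₀, ht₀⟩ := hT
  let e : ℕ → V := fun k => T.toList.getD k t₀
  have he : ∀ k, e k ∈ T := by
    intro k
    simp only [e, List.getD_eq_getElem?_getD]
    rcases lt_or_ge k T.toList.length with h | h
    · rw [List.getElem?_eq_getElem h, Option.getD_some]
      exact Finset.mem_toList.1 (List.getElem_mem h)
    · rw [List.getElem?_eq_none h]
      exact ht₀
  refine ⟨SimpleFunc.nearestPt e T.toList.length, fun z => ⟨he _, fun t ht => ?_⟩⟩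
  obtain ⟨k, hk, rfl⟩ := List.getElem_of_mem (Finset.mem_toList.2 ht)
  have := SimpleFunc.edist_nearestPt_le e z hk.le
  rw [edist_dist, edist_dist, ENNReal.ofReal_le_ofReal_iff dist_nonneg] at this
  rw [dist_comm z, dist_comm z]
  refine this.trans_eq ?_
  simp [e, List.getElem?_eq_getElem hk]

variable {V : Type*} [NormedAddCommGroup V] [InnerProductSpace ℝ V]

/-- The Gaussian density proportional to `exp (-a * ‖z - x‖ ^ 2)`. -/
noncomputable def gaussDensity (a : ℝ) (x z : V) : ℝ :=
  (a / π) ^ (Module.finrank ℝ V / 2 : ℝ) * rexp (-a * ‖z - x‖ ^ 2)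

theorem gaussDensity_pos {a : ℝ} (ha : 0 < a) (x z : V) : 0 < gaussDensity a x z := by
  unfold gaussDensity
  positivity

/-- Completing the square; a < 2b keeps the resulting Gaussian integrable. -/
theorem gaussDensity_sq_div {a b : ℝ} (ha : 0 < a) (hb : 0 < b) (hab : a < 2 * b) (x y z : V) :
    gaussDensity b y z ^ 2 / gaussDensity a x z =
      (b ^ 2 / (a * π)) ^ (Module.finrank ℝ V / 2 : ℝ) *
        rexp (2 * a * b / (2 * b - a) * ‖x - y‖ ^ 2) *
        rexp (-(2 * b - a) * ‖z - (x + (2 * b / (2 * b - a)) • (y - x))‖ ^ 2) := by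
  unfold gaussDensity
  have h2 : 2 * b - a ≠ 0 := by linarith
  have e1 : (b ^ 2 / (a * π)) ^ (Module.finrank ℝ V / 2 : ℝ) =
      (b / π) ^ (Module.finrank ℝ V / 2 : ℝ) * (b / π) ^ (Module.finrank ℝ V / 2 : ℝ) /
        (a / π) ^ (Module.finrank ℝ V / 2 : ℝ) := by
    rw [← mul_rpow (by positivity) (by positivity), ← div_rpow (by positivity) (by positivity)]
    congr 1
    field_simp
  rw [e1, mul_pow, mul_div_mul_comm, sq, ← Real.exp_nat_mul, ← Real.exp_sub, mul_assoc, ← Real.exp_add]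
  congr 2
  obtain ⟨u, hu⟩ : ∃ u, u = z - x := ⟨_, rfl⟩
  have hzy : z - y = u - (y - x) := by rw [hu]; abel
  have hz : z - (x + (2 * b / (2 * b - a)) • (y - x)) = u - (2 * b / (2 * b - a)) • (y - x) := by
    rw [hu]; abel
  rw [hzy, hz, ← hu, norm_sub_rev x y]
  generalize y - x = h
  rw [norm_sub_sq_real, norm_sub_sq_real, real_inner_smul_right, norm_smul, mul_pow, Real.norm_eq_abs, sq_abs]
  push_cast
  field_simp
  ring

variable [FiniteDimensional ℝ V] [MeasurableSpace V] [BorelSpace V]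

theorem integrable_exp_neg_mul_norm_sub_sq {b : ℝ} (hb : 0 < b) (x : V) :
    Integrable fun z : V => rexp (-b * ‖z - x‖ ^ 2) := by
  have h : Integrable fun z : V => rexp (-b * ‖z‖ ^ 2) := by
    have := (GaussianFourier.integrable_cexp_neg_mul_sq_norm_add (V := V) (b := (b : ℂ))
      (by simpa using hb) 0 0).norm
    refine this.congr (Filter.Eventually.of_forall fun z => ?_)
    simp only [Complex.norm_exp]
    congr 1
    norm_cast
    simp
  exact h.comp_sub_right x

theorem integral_exp_neg_mul_norm_sub_sq {b : ℝ} (hb : 0 < b) (x : V) :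
    ∫ z : V, rexp (-b * ‖z - x‖ ^ 2) = (π / b) ^ (Module.finrank ℝ V / 2 : ℝ) := by
  rw [integral_sub_right_eq_self (fun z : V => rexp (-b * ‖z‖ ^ 2)) x]
  exact GaussianFourier.integral_rexp_neg_mul_sq_norm hb

theorem integrable_gaussDensity {a : ℝ} (ha : 0 < a) (x : V) :
    Integrable (gaussDensity a x) :=
  (integrable_exp_neg_mul_norm_sub_sq ha x).const_mul _

theorem integral_gaussDensity {a : ℝ} (ha : 0 < a) (x : V) :
    ∫ z, gaussDensity a x z = 1 := by
  unfold gaussDensity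
  rw [integral_const_mul, integral_exp_neg_mul_norm_sub_sq ha,
    ← mul_rpow (by positivity) (by positivity), div_mul_div_cancel₀ (by positivity),
    div_self ha.ne', one_rpow]

theorem integrable_gaussDensity_sq_div {a b : ℝ} (ha : 0 < a) (hb : 0 < b) (hab : a < 2 * b)
    (x y : V) : Integrable fun z => gaussDensity b y z ^ 2 / gaussDensity a x z := by
  simp only [gaussDensity_sq_div ha hb hab]
  exact (integrable_exp_neg_mul_norm_sub_sq (by linarith) _).const_mul _

theorem integral_gaussDensity_sq_div {a b : ℝ} (ha : 0 < a) (hb : 0 < b) (hab : a < 2 * b)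
    (x y : V) : ∫ z, gaussDensity b y z ^ 2 / gaussDensity a x z =
      (b ^ 2 / (a * (2 * b - a))) ^ (Module.finrank ℝ V / 2 : ℝ) *
        rexp (2 * a * b / (2 * b - a) * ‖x - y‖ ^ 2) := by
  simp only [gaussDensity_sq_div ha hb hab]
  have h2 : 0 < 2 * b - a := by linarith
  rw [integral_const_mul, integral_exp_neg_mul_norm_sub_sq h2, mul_right_comm,
    ← mul_rpow (by positivity) (by positivity)]
  congr 2
  field_simp

/-- The prefactor is 1 + (a - b)² / (a (2b - a)) ≤ 1 + 8τ²: the change of variance enters only to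
second order, so raising it to the power d/2 costs exp (4dτ²). The change of centre contributes
another exp (4dτ²). -/
theorem integral_gaussDensity_sq_div_le {a b τ : ℝ} (ha : 0 < a) (hba : b ≤ a)
    (hτ : a * (1 - 2 * τ) ≤ b) (hτ8 : τ ≤ 1 / 8) (x y : V)
    (hxy : a * ‖x - y‖ ^ 2 ≤ Module.finrank ℝ V * τ ^ 2)
    (hd : Module.finrank ℝ V * τ ^ 2 ≤ 1 / 8) :
    ∫ z, gaussDensity b y z ^ 2 / gaussDensity a x z ≤
      1 + 16 * (Module.finrank ℝ V * τ ^ 2) := by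
  have hb : 0 < b := by nlinarith
  have hba2 : a / 2 ≤ 2 * b - a := by nlinarith
  rw [integral_gaussDensity_sq_div ha hb (by linarith)]
  set d : ℝ := (Module.finrank ℝ V : ℝ)
  have hd0 : 0 ≤ d := Nat.cast_nonneg _
  have h2 : 0 < 2 * b - a := by linarith
  have h1 : b ^ 2 / (a * (2 * b - a)) ≤ rexp (8 * τ ^ 2) := by
    refine le_trans ?_ (Real.add_one_le_exp _)
    rw [div_le_iff₀ (by positivity)]
    have h3 : (a - b) ^ 2 ≤ (2 * τ * a) ^ 2 := by
      apply pow_le_pow_left₀ <;> linarith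
    have h4 : 8 * τ ^ 2 * (a * (a / 2)) ≤ 8 * τ ^ 2 * (a * (2 * b - a)) := by gcongr
    nlinarith
  have h5 : 2 * a * b / (2 * b - a) * ‖x - y‖ ^ 2 ≤ 4 * (d * τ ^ 2) := by
    have : 2 * a * b / (2 * b - a) ≤ 4 * a := by
      rw [div_le_iff₀ h2]
      nlinarith
    calc _ ≤ 4 * a * ‖x - y‖ ^ 2 := by gcongr
      _ ≤ _ := by linarith
  calc _ ≤ (rexp (8 * τ ^ 2)) ^ (d / 2) * rexp (4 * (d * τ ^ 2)) := by gcongr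
    _ = rexp (8 * (d * τ ^ 2)) := by
        rw [← Real.exp_mul, ← Real.exp_add]
        congr 1
        ring
    _ ≤ _ := by
        have h6 : 0 ≤ 8 * (d * τ ^ 2) := by positivity
        have h7 := Real.abs_exp_sub_one_le (x := 8 * (d * τ ^ 2)) (by
          rw [abs_of_nonneg h6]; linarith)
        rw [abs_of_nonneg h6] at h7
        have := le_abs_self (rexp (8 * (d * τ ^ 2)) - 1)
        linarith

theorem gaussDensity_second_moment {a : ℝ} (ha : 0 < a) (hd : 0 < Module.finrank ℝ V) (x : V) :
    Integrable (fun z => gaussDensity a x z * ‖z - x‖ ^ 2) ∧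
      ∫ z, gaussDensity a x z * ‖z - x‖ ^ 2 ≤ 4 * Module.finrank ℝ V / a := by
  set d : ℝ := (Module.finrank ℝ V : ℝ) with hdd
  have hd1 : 1 ≤ d := by rw [hdd]; exact_mod_cast hd
  -- Bounding ‖z - x‖² by s⁻¹ exp (s‖z - x‖²) reduces the moment to a Gaussian integral; s of order
  -- a/d keeps the factor (a / (a - s))^(d/2) below 2.
  let s := a / (2 * d)
  have hs : 0 < s := by positivity
  have hsa : s ≤ a / 2 := by
    simp only [s]
    gcongr
    linarith
  have has : 0 < a - s := by linarith
  have hle : ∀ z : V, gaussDensity a x z * ‖z - x‖ ^ 2 ≤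
      (a / π) ^ (d / 2) * s⁻¹ * rexp (-(a - s) * ‖z - x‖ ^ 2) := by
    intro z
    have h1 : ‖z - x‖ ^ 2 ≤ s⁻¹ * rexp (s * ‖z - x‖ ^ 2) := by
      rw [le_inv_mul_iff₀ hs]
      linarith [Real.add_one_le_exp (s * ‖z - x‖ ^ 2)]
    unfold gaussDensity
    calc _ ≤ (a / π) ^ (d / 2) * rexp (-a * ‖z - x‖ ^ 2) * (s⁻¹ * rexp (s * ‖z - x‖ ^ 2)) := by
          gcongr
      _ = (a / π) ^ (d / 2) * s⁻¹ * (rexp (-a * ‖z - x‖ ^ 2) * rexp (s * ‖z - x‖ ^ 2)) := by ring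
      _ = _ := by
          rw [← Real.exp_add]
          congr 2
          ring
  have hint : Integrable fun z : V =>
      (a / π) ^ (d / 2) * s⁻¹ * rexp (-(a - s) * ‖z - x‖ ^ 2) :=
    (integrable_exp_neg_mul_norm_sub_sq has x).const_mul _
  have hint' : Integrable fun z => gaussDensity a x z * ‖z - x‖ ^ 2 := by
    refine hint.mono' ?_ (Filter.Eventually.of_forall fun z => ?_)
    · unfold gaussDensity
      exact Continuous.aestronglyMeasurable (by fun_prop)
    · have := gaussDensity_pos ha x z
      rw [Real.norm_of_nonneg (by positivity)]
      exact hle z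
  refine ⟨hint', (integral_mono hint' hint hle).trans ?_⟩
  rw [integral_const_mul, integral_exp_neg_mul_norm_sub_sq has, ← hdd, mul_right_comm,
    ← mul_rpow (by positivity) (by positivity), div_mul_div_cancel₀ (by positivity)]
  have h1 : a / (a - s) ≤ rexp (1 / d) := by
    refine le_trans ?_ (Real.add_one_le_exp _)
    rw [div_le_iff₀ has]
    have : s = a / (2 * d) := rfl
    have e : (1 / d + 1) * (a - s) = a + s * (1 - 1 / d) := by
      rw [this]; field_simp; ring
    have : 1 / d ≤ 1 := by rw [div_le_one (by positivity)]; exact hd1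
    rw [e]
    nlinarith
  have h2 : (a / (a - s)) ^ (d / 2) ≤ 2 := by
    calc _ ≤ (rexp (1 / d)) ^ (d / 2) := by gcongr
      _ = rexp (1 / 2) := by
          rw [← Real.exp_mul]; congr 1; field_simp
      _ ≤ 2 := by
          have := Real.exp_one_lt_d9
          have h : rexp (1 / 2) * rexp (1 / 2) = rexp 1 := by
            rw [← Real.exp_add]; norm_num
          nlinarith [Real.exp_pos (1 / 2)]
  calc _ ≤ 2 * s⁻¹ := by gcongr
    _ = _ := by simp only [s]; field_simp; norm_num

theorem integral_gaussDensity_mul_sq_le {A : ℝ} (hA : 0 < A) (hd : 0 < Module.finrank ℝ V)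
    (x : V) :
    Integrable (fun z => gaussDensity (Module.finrank ℝ V / A ^ 2) x z * (2 * A + 2 * ‖z - x‖) ^ 2) ∧
      ∫ z, gaussDensity (Module.finrank ℝ V / A ^ 2) x z * (2 * A + 2 * ‖z - x‖) ^ 2 ≤
        40 * A ^ 2 := by
  have hd' : (0 : ℝ) < Module.finrank ℝ V := by exact_mod_cast hd
  set a := Module.finrank ℝ V / A ^ 2 with ha'
  have ha : 0 < a := by positivity
  obtain ⟨hi, hm⟩ := gaussDensity_second_moment ha hd x
  have hm' : 4 * Module.finrank ℝ V / a = 4 * A ^ 2 := by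
    rw [ha']; field_simp
  rw [hm'] at hm
  have hle : ∀ z, gaussDensity a x z * (2 * A + 2 * ‖z - x‖) ^ 2 ≤
      8 * A ^ 2 * gaussDensity a x z + 8 * (gaussDensity a x z * ‖z - x‖ ^ 2) := by
    intro z
    have := (gaussDensity_pos ha x z).le
    have h2 : (2 * A + 2 * ‖z - x‖) ^ 2 ≤ 8 * A ^ 2 + 8 * ‖z - x‖ ^ 2 := by
      nlinarith [sq_nonneg (A - ‖z - x‖)]
    nlinarith
  have hint : Integrable fun z =>
      8 * A ^ 2 * gaussDensity a x z + 8 * (gaussDensity a x z * ‖z - x‖ ^ 2) :=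
    ((integrable_gaussDensity ha x).const_mul _).add (hi.const_mul _)
  have hint' : Integrable fun z => gaussDensity a x z * (2 * A + 2 * ‖z - x‖) ^ 2 := by
    refine hint.mono' ?_ (Filter.Eventually.of_forall fun z => ?_)
    · unfold gaussDensity
      exact Continuous.aestronglyMeasurable (by fun_prop)
    · have := gaussDensity_pos ha x z
      rw [Real.norm_of_nonneg (by positivity)]
      exact hle z
  refine ⟨hint', (integral_mono hint' hint hle).trans ?_⟩
  rw [integral_add ((integrable_gaussDensity ha x).const_mul _) (hi.const_mul _),
    integral_const_mul, integral_const_mul, integral_gaussDensity ha]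
  linarith

variable {Z : Type*} [NormedAddCommGroup Z] [NormedSpace ℝ Z]

theorem integrable_gaussDensity_smul {a : ℝ} (ha : 0 < a) (x : V) (f : SimpleFunc V Z) :
    Integrable fun z => gaussDensity a x z • f z := by
  obtain ⟨C, hC⟩ := f.exists_forall_norm_le
  refine ((integrable_gaussDensity ha x).mul_const C).mono'
    ((integrable_gaussDensity ha x).aestronglyMeasurable.smul f.aestronglyMeasurable)
    (Filter.Eventually.of_forall fun z => ?_)
  have := (gaussDensity_pos ha x z).le
  rw [norm_smul, Real.norm_of_nonneg this]
  gcongr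
  exact hC z

variable [CompleteSpace Z]

theorem integral_gaussDensity_smul_sub_const {a : ℝ} (ha : 0 < a) (x : V) (f : SimpleFunc V Z)
    (c : Z) : (∫ z, gaussDensity a x z • f z) - c = ∫ z, gaussDensity a x z • (f z - c) := by
  simp only [smul_sub]
  rw [integral_sub (integrable_gaussDensity_smul ha x f)
    ((integrable_gaussDensity ha x).smul_const c), integral_smul_const, integral_gaussDensity ha,
    one_smul]

theorem norm_integral_gaussDensity_smul_sub_le {A L : ℝ} (hA : 0 < A) (hL : 0 ≤ L)
    (hd : 0 < Module.finrank ℝ V) (x : V) (f : SimpleFunc V Z) (c : Z)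
    (hf : ∀ z, ‖f z - c‖ ≤ L * (2 * A + 2 * ‖z - x‖)) :
    ‖(∫ z, gaussDensity (Module.finrank ℝ V / A ^ 2) x z • f z) - c‖ ≤ 11 * L * A := by
  have hd' : (0 : ℝ) < Module.finrank ℝ V := by exact_mod_cast hd
  obtain ⟨hi, hm⟩ := integral_gaussDensity_mul_sq_le hA hd x
  set a := Module.finrank ℝ V / A ^ 2
  have ha : 0 < a := by positivity
  rw [integral_gaussDensity_smul_sub_const ha]
  have hint : Integrable fun z => L * (A * gaussDensity a x z +
      (4 * A)⁻¹ * (gaussDensity a x z * (2 * A + 2 * ‖z - x‖) ^ 2)) :=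
    (((integrable_gaussDensity ha x).const_mul _).add (hi.const_mul _)).const_mul _
  refine (norm_integral_le_of_norm_le hint (Filter.Eventually.of_forall fun z => ?_)).trans ?_
  · have hp := (gaussDensity_pos ha x z).le
    rw [norm_smul, Real.norm_of_nonneg hp]
    have h1 : 2 * A + 2 * ‖z - x‖ ≤ A + (4 * A)⁻¹ * (2 * A + 2 * ‖z - x‖) ^ 2 := by
      have : A + (4 * A)⁻¹ * (2 * A + 2 * ‖z - x‖) ^ 2 - (2 * A + 2 * ‖z - x‖) =
          ‖z - x‖ ^ 2 / A := by field_simp; ring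
      have h3 : 0 ≤ ‖z - x‖ ^ 2 / A := by positivity
      linarith
    calc _ ≤ gaussDensity a x z * (L * (A + (4 * A)⁻¹ * (2 * A + 2 * ‖z - x‖) ^ 2)) := by
          gcongr
          exact (hf z).trans (by gcongr)
      _ = _ := by ring
  · rw [integral_const_mul, integral_add ((integrable_gaussDensity ha x).const_mul _)
      (hi.const_mul _), integral_const_mul, integral_const_mul, integral_gaussDensity ha]
    calc _ ≤ L * (A * 1 + (4 * A)⁻¹ * (40 * A ^ 2)) := by gcongr
      _ = _ := by field_simp; ring

/-- Weighted Cauchy–Schwarz: the integral of |p - q| w is controlled by the chi-squared integral of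
(p - q)²/p, at most 16dδ²/A², and by the p-mean of w², at most 40A². The product has order √d δ,
independent of A. -/
theorem norm_integral_gaussDensity_smul_sub_integral_le {A B δ L : ℝ} (hA : 0 < A) (hAB : A ≤ B)
    (hBA : B ≤ A + δ) (hδ : 0 < δ) (hL : 0 ≤ L) (hd : 0 < Module.finrank ℝ V) {x y : V}
    (hxy : dist x y ≤ δ) (hδA : 8 * √(Module.finrank ℝ V) * δ ≤ A) (f : SimpleFunc V Z) (c : Z)
    (hf : ∀ z, ‖f z - c‖ ≤ L * (2 * A + 2 * ‖z - x‖)) :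
    ‖(∫ z, gaussDensity (Module.finrank ℝ V / A ^ 2) x z • f z) -
      ∫ z, gaussDensity (Module.finrank ℝ V / B ^ 2) y z • f z‖ ≤
      26 * √(Module.finrank ℝ V) * L * δ := by
  have hd' : (1 : ℝ) ≤ Module.finrank ℝ V := by exact_mod_cast hd
  have hB : 0 < B := by linarith
  obtain ⟨hi, hm⟩ := integral_gaussDensity_mul_sq_le hA hd x
  set d : ℝ := (Module.finrank ℝ V : ℝ) with hdd
  have hsd : 1 ≤ √d := by rw [Real.one_le_sqrt]; exact hd'
  have hsd2 : √d * √d = d := Real.mul_self_sqrt (by linarith)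
  set a := d / A ^ 2 with ha'
  set b := d / B ^ 2 with hb'
  have ha : 0 < a := by positivity
  have hb : 0 < b := by positivity
  have hba : b ≤ a := by simp only [ha', hb']; gcongr
  set τ := δ / A with hτ'
  have hτ0 : 0 < τ := by positivity
  have hτA : τ * A = δ := by rw [hτ']; field_simp
  have hθ8 : √d * τ ≤ 1 / 8 := by
    rw [hτ', mul_div_assoc', div_le_iff₀ hA]; linarith
  have hτ8 : τ ≤ 1 / 8 := by nlinarith
  have hdτ : d * τ ^ 2 = (√d * τ) ^ 2 := by rw [mul_pow, sq √d, hsd2]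
  have hdτ8 : d * τ ^ 2 ≤ 1 / 8 := by
    rw [hdτ]
    have : 0 ≤ √d * τ := by positivity
    nlinarith
  have hab : a * (1 - 2 * τ) ≤ b := by
    simp only [ha', hb']
    rw [div_mul_eq_mul_div, div_le_div_iff₀ (by positivity) (by positivity), mul_assoc]
    refine mul_le_mul_of_nonneg_left ?_ (by positivity)
    have h1 : B ^ 2 ≤ (A * (1 + τ)) ^ 2 := by
      apply pow_le_pow_left₀ hB.le; linarith
    have h2 : (1 + τ) ^ 2 * (1 - 2 * τ) ≤ 1 := by nlinarith [sq_nonneg τ]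
    calc (1 - 2 * τ) * B ^ 2 ≤ (1 - 2 * τ) * (A * (1 + τ)) ^ 2 := by
          refine mul_le_mul_of_nonneg_left h1 (by linarith)
      _ = A ^ 2 * ((1 + τ) ^ 2 * (1 - 2 * τ)) := by ring
      _ ≤ A ^ 2 * 1 := by gcongr
      _ = A ^ 2 := mul_one _
  have hxy2 : a * ‖x - y‖ ^ 2 ≤ d * τ ^ 2 := by
    rw [dist_eq_norm] at hxy
    calc a * ‖x - y‖ ^ 2 ≤ a * δ ^ 2 := by gcongr
      _ = _ := by rw [ha', hτ']; field_simp
  have hchi := integral_gaussDensity_sq_div_le ha hba hab hτ8 x y hxy2 hdτ8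
  rw [← hdd] at hchi
  have hab2 : a < 2 * b := by nlinarith
  have hiq := integrable_gaussDensity_sq_div ha hb hab2 x y
  have e0 : (∫ z, gaussDensity a x z • f z) - ∫ z, gaussDensity b y z • f z =
      ∫ z, (gaussDensity a x z - gaussDensity b y z) • (f z - c) := by
    have h1 := integral_gaussDensity_smul_sub_const ha x f c
    have h2 := integral_gaussDensity_smul_sub_const hb y f c
    have h3 : ∫ z, (gaussDensity a x z - gaussDensity b y z) • (f z - c) =
        (∫ z, gaussDensity a x z • (f z - c)) - ∫ z, gaussDensity b y z • (f z - c) := by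
      simp only [sub_smul]
      refine integral_sub ?_ ?_
      · simp only [smul_sub]
        exact (integrable_gaussDensity_smul ha x f).sub
          ((integrable_gaussDensity ha x).smul_const c)
      · simp only [smul_sub]
        exact (integrable_gaussDensity_smul hb y f).sub
          ((integrable_gaussDensity hb y).smul_const c)
    rw [h3, ← h1, ← h2]
    abel
  rw [e0]
  -- The parameter that balances the chi-squared term 16s(√d τ)² against the moment term 10A²/s.
  set s := (√d * τ)⁻¹ * A with hs'
  have hs : 0 < s := by positivity
  have hint1 : Integrable fun z => gaussDensity b y z ^ 2 / gaussDensity a x z -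
      2 * gaussDensity b y z + gaussDensity a x z :=
    (hiq.sub ((integrable_gaussDensity hb y).const_mul _)).add (integrable_gaussDensity ha x)
  have hsum : ∫ z, (gaussDensity b y z ^ 2 / gaussDensity a x z -
      2 * gaussDensity b y z + gaussDensity a x z) ≤ 16 * (d * τ ^ 2) := by
    have h1 : ∫ z, (gaussDensity b y z ^ 2 / gaussDensity a x z - 2 * gaussDensity b y z) =
        (∫ z, gaussDensity b y z ^ 2 / gaussDensity a x z) - ∫ z, 2 * gaussDensity b y z :=
      integral_sub hiq ((integrable_gaussDensity hb y).const_mul _)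
    have h2 : ∫ z, (gaussDensity b y z ^ 2 / gaussDensity a x z -
        2 * gaussDensity b y z + gaussDensity a x z) =
        (∫ z, (gaussDensity b y z ^ 2 / gaussDensity a x z - 2 * gaussDensity b y z)) +
          ∫ z, gaussDensity a x z :=
      integral_add (hiq.sub ((integrable_gaussDensity hb y).const_mul _))
        (integrable_gaussDensity ha x)
    rw [h2, h1, integral_const_mul, integral_gaussDensity ha, integral_gaussDensity hb]
    linarith
  have hint : Integrable fun z => L * (s * (gaussDensity b y z ^ 2 / gaussDensity a x z -
      2 * gaussDensity b y z + gaussDensity a x z) +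
      (4 * s)⁻¹ * (gaussDensity a x z * (2 * A + 2 * ‖z - x‖) ^ 2)) :=
    ((hint1.const_mul _).add (hi.const_mul _)).const_mul _
  refine (norm_integral_le_of_norm_le hint (Filter.Eventually.of_forall fun z => ?_)).trans ?_
  · have hp := gaussDensity_pos ha x z
    rw [norm_smul, Real.norm_eq_abs]
    set p := gaussDensity a x z
    set q := gaussDensity b y z
    set w := 2 * A + 2 * ‖z - x‖
    have key : |p - q| * w ≤ s * (q ^ 2 / p - 2 * q + p) + (4 * s)⁻¹ * (p * w ^ 2) := by
      have e : s * (q ^ 2 / p - 2 * q + p) + (4 * s)⁻¹ * (p * w ^ 2) - |p - q| * w =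
          (s / p) * (|p - q| - p * w / (2 * s)) ^ 2 := by
        rw [sub_sq, sq_abs]
        field_simp
        ring
      have : 0 ≤ (s / p) * (|p - q| - p * w / (2 * s)) ^ 2 := by positivity
      linarith
    calc |p - q| * ‖f z - c‖ ≤ |p - q| * (L * w) := by gcongr; exact hf z
      _ = L * (|p - q| * w) := by ring
      _ ≤ _ := by gcongr
  · rw [integral_const_mul, integral_add (hint1.const_mul _) (hi.const_mul _),
      integral_const_mul, integral_const_mul]
    calc _ ≤ L * (s * (16 * (d * τ ^ 2)) + (4 * s)⁻¹ * (40 * A ^ 2)) := by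
          gcongr
      _ = L * (26 * (√d * (τ * A))) := by
          rw [hdτ, hs']
          field_simp
          ring
      _ = _ := by rw [hτA]; ring

/-- Gaussian averages of a nearest point map at the scale of the distance to the domain. -/
theorem finExt_finrank (V : Type*) [NormedAddCommGroup V] [InnerProductSpace ℝ V]
    [FiniteDimensional ℝ V] (hd : 0 < Module.finrank ℝ V) (Z : Type*) [NormedAddCommGroup Z]
    [NormedSpace ℝ Z] [CompleteSpace Z] (m : ℕ) :
    FinExt V Z m (300 * √(Module.finrank ℝ V)) := by
  classical
  let _ : MeasurableSpace V := borel V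
  have _ : BorelSpace V := ⟨rfl⟩
  intro T N φ L hT hTN hN hL hφ
  have hTne : (T : Set V).Nonempty := hT
  let A : V → ℝ := fun x => Metric.infDist x T
  have hA0 : ∀ x, 0 ≤ A x := fun x => Metric.infDist_nonneg
  have hAδ : ∀ x y, A x ≤ A y + dist x y := fun x y => Metric.infDist_le_infDist_add_dist
  obtain ⟨ν, hν⟩ := exists_simpleFunc_nearest T hT
  have hνA : ∀ x, dist x (ν x) = A x := by
    intro x
    obtain ⟨t, ht, h⟩ := T.finite_toSet.isCompact.exists_infDist_eq_dist hTne x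
    refine le_antisymm ?_ (Metric.infDist_le_dist_of_mem (hν x).1)
    change _ ≤ Metric.infDist x T
    rw [h]
    exact (hν x).2 t ht
  let f : SimpleFunc V Z := ν.map φ
  have hf : ∀ x z, ‖f z - φ (ν x)‖ ≤ L * (2 * A x + 2 * ‖z - x‖) := by
    intro x z
    rw [← dist_eq_norm, ← dist_eq_norm]
    refine (hφ _ (hν z).1 _ (hν x).1).trans ?_
    gcongr
    have h1 := dist_triangle4 (ν z) z x (ν x)
    rw [dist_comm (ν z) z, hνA, hνA] at h1
    linarith [hAδ z x]
  set d : ℝ := (Module.finrank ℝ V : ℝ) with hdd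
  have hd' : (1 : ℝ) ≤ d := by rw [hdd]; exact_mod_cast hd
  have hsd : 1 ≤ √d := by rw [Real.one_le_sqrt]; exact hd'
  let Φ : V → Z := fun x => if A x = 0 then φ x else ∫ z, gaussDensity (d / A x ^ 2) x z • f z
  have hΦ : ∀ x, ‖Φ x - φ (ν x)‖ ≤ 11 * L * A x := by
    intro x
    by_cases h : A x = 0
    · have : x = ν x := by have := hνA x; rwa [h, dist_eq_zero] at this
      simp only [Φ, h, if_true]
      rw [← this]
      simp
    · simp only [Φ, h, if_false]
      exact norm_integral_gaussDensity_smul_sub_le (lt_of_le_of_ne (hA0 x) (Ne.symm h)) hL hd x f _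
        (hf x)
  -- The threshold 8√d is where the chi-squared estimate starts to apply; below it, comparison
  -- through nearest points already loses only a multiple of √d.
  have hfar : ∀ x y, A x ≤ 8 * √d * dist x y → dist (Φ x) (Φ y) ≤ 300 * √d * L * dist x y := by
    intro x y hxy
    have h1 := hΦ x
    have h2 := hΦ y
    have h3 := hφ _ (hν x).1 _ (hν y).1
    rw [← dist_eq_norm] at h1 h2
    have h4 := dist_triangle4 (Φ x) (φ (ν x)) (φ (ν y)) (Φ y)
    rw [dist_comm (φ (ν y)) (Φ y)] at h4
    have h5 := dist_triangle4 (ν x) x y (ν y)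
    rw [dist_comm (ν x) x, hνA, hνA] at h5
    have h6 := hAδ y x
    rw [dist_comm y x] at h6
    have h7 : dist x y ≤ √d * dist x y := by
      have := dist_nonneg (x := x) (y := y); nlinarith
    calc _ ≤ 11 * L * A x + L * dist (ν x) (ν y) + 11 * L * A y := by linarith
      _ ≤ 11 * L * (8 * √d * dist x y) + L * (18 * (√d * dist x y)) +
          11 * L * (9 * (√d * dist x y)) := by
          gcongr <;> linarith
      _ ≤ _ := by
          have : 0 ≤ L * (√d * dist x y) := by positivity
          nlinarith
  have hclose : ∀ x y, A x ≤ A y → 8 * √d * dist x y < A x →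
      dist (Φ x) (Φ y) ≤ 300 * √d * L * dist x y := by
    intro x y hAB hxy
    by_cases hne : x = y
    · simp [hne]
    have hδ := dist_pos.2 hne
    have hx : 0 < A x := lt_of_le_of_lt (by positivity) hxy
    have hy : 0 < A y := by linarith
    have hyx := hAδ y x
    rw [dist_comm y x] at hyx
    rw [dist_eq_norm]
    simp only [Φ, hx.ne', hy.ne', if_false]
    refine (norm_integral_gaussDensity_smul_sub_integral_le hx hAB hyx hδ hL hd le_rfl hxy.le f _
      (hf x)).trans ?_
    gcongr
    norm_num
  refine ⟨Φ, fun t ht => ?_, fun x _ y _ => ?_⟩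
  · have : A t = 0 := Metric.infDist_zero_of_mem (by exact_mod_cast ht)
    simp [Φ, this]
  · rcases le_or_gt (A x) (8 * √d * dist x y) with h | h
    · exact hfar x y h
    rcases le_or_gt (A y) (8 * √d * dist x y) with h' | h'
    · rw [dist_comm, dist_comm x]
      exact hfar y x (by rwa [dist_comm y x])
    rcases le_total (A x) (A y) with h'' | h''
    · exact hclose x y h'' h
    · rw [dist_comm, dist_comm x]
      exact hclose y x h'' (by rwa [dist_comm y x])

end Gaussian

/-! ### A discrete random variable with tail of order p -/

section HeavyTail

open Real

/-- The right side is a potential adapted to the induction: for z = y 2^J ≤ 1 its first part grows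
by exactly z^α, and for z > 1 its second part grows by exactly z^(-β). -/
theorem sum_range_dyadic_min_le {α β : ℝ} (hα : 0 < α) (hβ : 0 < β) {y : ℝ} (hy : 0 < y) (J : ℕ) :
    ∑ j ∈ Finset.range J, min ((y * 2 ^ j) ^ α) ((y * 2 ^ j) ^ (-β)) ≤
      (1 - 2 ^ (-α))⁻¹ * min (y * 2 ^ J / 2) 1 ^ α +
        (1 - 2 ^ (-β))⁻¹ * (1 - max (y * 2 ^ J) 1 ^ (-β)) := by
  have hcα : 0 < 1 - (2 : ℝ) ^ (-α) := by
    have := Real.rpow_lt_one_of_one_lt_of_neg (x := 2) (by norm_num) (neg_lt_zero.2 hα)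
    linarith
  have hcβ : 0 < 1 - (2 : ℝ) ^ (-β) := by
    have := Real.rpow_lt_one_of_one_lt_of_neg (x := 2) (by norm_num) (neg_lt_zero.2 hβ)
    linarith
  have hmono : ∀ u v : ℝ, 1 ≤ u → u ≤ v → v ^ (-β) ≤ u ^ (-β) := fun u v hu huv =>
    Real.rpow_le_rpow_of_nonpos (by linarith) huv (by linarith)
  induction J with
  | zero =>
    have h1 : max (y * 2 ^ 0) 1 ^ (-β) ≤ 1 := by
      have := hmono 1 _ le_rfl (le_max_right (y * 2 ^ 0) 1)
      simpa using this
    have : 0 ≤ 1 - max (y * 2 ^ 0) 1 ^ (-β) := by linarith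
    rw [Finset.range_zero, Finset.sum_empty]
    positivity
  | succ J ih =>
    rw [Finset.sum_range_succ]
    refine (add_le_add_left ih _).trans ?_
    have e : y * 2 ^ (J + 1) = 2 * (y * 2 ^ J) := by ring
    rw [e]
    set z := y * 2 ^ J
    have hz : 0 < z := by positivity
    rw [mul_div_cancel_left₀ z (by norm_num : (2 : ℝ) ≠ 0)]
    rcases le_or_gt z 1 with h | h
    · rw [min_eq_left (by linarith : z / 2 ≤ 1), min_eq_left h, max_eq_right h]
      have h1 := hmono 1 _ le_rfl (le_max_right (2 * z) 1)
      have h2 : min (z ^ α) (z ^ (-β)) ≤ z ^ α := min_le_left _ _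
      have h3 : (1 - (2 : ℝ) ^ (-α))⁻¹ * (z / 2) ^ α + z ^ α = (1 - (2 : ℝ) ^ (-α))⁻¹ * z ^ α := by
        rw [div_eq_mul_inv, mul_rpow hz.le (by norm_num), inv_rpow (by norm_num),
          ← rpow_neg (by norm_num)]
        field_simp
        ring
      have h4 : (1 - (2 : ℝ) ^ (-β))⁻¹ * (1 - 1 ^ (-β)) ≤
          (1 - (2 : ℝ) ^ (-β))⁻¹ * (1 - max (2 * z) 1 ^ (-β)) := by gcongr
      linarith
    · rw [min_eq_right h.le, max_eq_left h.le, max_eq_left (by linarith)]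
      have h1 : (1 - (2 : ℝ) ^ (-α))⁻¹ * min (z / 2) 1 ^ α ≤ (1 - (2 : ℝ) ^ (-α))⁻¹ * 1 ^ α := by
        gcongr
        exact min_le_right _ _
      have h2 : min (z ^ α) (z ^ (-β)) ≤ z ^ (-β) := min_le_right _ _
      have h3 : (1 - (2 : ℝ) ^ (-β))⁻¹ * (1 - z ^ (-β)) + z ^ (-β) =
          (1 - (2 : ℝ) ^ (-β))⁻¹ * (1 - (2 * z) ^ (-β)) := by
        rw [mul_rpow (by norm_num) hz.le]
        field_simp
        ring
      linarith

/-- With z = y 2^j and y > 0 each term is y^p min (z^(2-p), z^(1-p)), a two-sided geometric series;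
1 < p < 2 makes both sides decay. -/
theorem exists_sum_range_dyadic_le {p : ℝ} (hp1 : 1 < p) (hp2 : p < 2) :
    ∃ C : ℝ, 0 < C ∧ ∀ (y : ℝ), 0 ≤ y → ∀ J : ℕ,
      ∑ j ∈ Finset.range J, ((2 : ℝ) ^ j) ^ (-p) * min ((y * 2 ^ j) ^ 2) (y * 2 ^ j) ≤
        C * y ^ p := by
  have hcα : 0 < 1 - (2 : ℝ) ^ (-(2 - p)) := by
    have := Real.rpow_lt_one_of_one_lt_of_neg (x := 2) (z := -(2 - p)) (by norm_num) (by linarith)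
    linarith
  have hcβ : 0 < 1 - (2 : ℝ) ^ (-(p - 1)) := by
    have := Real.rpow_lt_one_of_one_lt_of_neg (x := 2) (z := -(p - 1)) (by norm_num) (by linarith)
    linarith
  refine ⟨(1 - (2 : ℝ) ^ (-(2 - p)))⁻¹ + (1 - (2 : ℝ) ^ (-(p - 1)))⁻¹, by positivity,
    fun y hy J => ?_⟩
  rcases hy.eq_or_lt with rfl | hy
  · simp [Real.zero_rpow (by linarith : p ≠ 0)]
  have hterm : ∀ j : ℕ, ((2 : ℝ) ^ j) ^ (-p) * min ((y * 2 ^ j) ^ 2) (y * 2 ^ j) =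
      y ^ p * min ((y * 2 ^ j) ^ (2 - p)) ((y * 2 ^ j) ^ (-(p - 1))) := by
    intro j
    have h2j : (0 : ℝ) < 2 ^ j := by positivity
    have e1 : ((2 : ℝ) ^ j) ^ (-p) = y ^ p * (y * 2 ^ j) ^ (-p) := by
      rw [mul_rpow hy.le h2j.le, ← mul_assoc, ← rpow_add hy]
      simp
    set z := y * 2 ^ j
    have hz : 0 < z := by positivity
    rw [e1, mul_assoc, mul_min_of_nonneg _ _ (by positivity)]
    congr 2
    · rw [← rpow_natCast z 2, ← rpow_add hz]
      congr 1
      push_cast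
      ring
    · nth_rewrite 2 [← rpow_one z]
      rw [← rpow_add hz]
      congr 1
      ring
  simp only [hterm]
  rw [← Finset.mul_sum, mul_comm]
  gcongr
  refine (sum_range_dyadic_min_le (by linarith) (by linarith) hy J).trans ?_
  have h1 : min (y * 2 ^ J / 2) 1 ^ (2 - p) ≤ 1 :=
    rpow_le_one (by positivity) (min_le_right _ _) (by linarith)
  have h2 : 0 ≤ max (y * 2 ^ J) 1 ^ (-(p - 1)) := by positivity
  calc _ ≤ (1 - (2 : ℝ) ^ (-(2 - p)))⁻¹ * 1 + (1 - (2 : ℝ) ^ (-(p - 1)))⁻¹ * 1 := by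
        gcongr
        linarith
    _ = _ := by ring

/-- A finitely supported truncation of a random variable with tail `s ^ (-p)`. -/
theorem exists_heavyTail {p : ℝ} (hp1 : 1 < p) (hp2 : p < 2) :
    ∃ C : ℝ, 0 < C ∧ ∀ J : ℕ, ∃ q : Fin (J + 1) → ℝ, (∀ j, 0 ≤ q j) ∧ ∑ j, q j = 1 ∧
      (∀ y : ℝ, 0 ≤ y → ∑ j, q j * min ((y * 2 ^ (j : ℕ)) ^ 2) (y * 2 ^ (j : ℕ)) ≤ C * y ^ p) ∧
      (∀ y : ℝ, 0 ≤ y → y ≤ 1 → (y ≠ 0 → 1 ≤ y * 2 ^ J) →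
        ∑ j, q j * rexp (-(y * 2 ^ (j : ℕ)) ^ 2) ≤ rexp (-(y ^ p / 16))) := by
  obtain ⟨C, hC, hmom⟩ := exists_sum_range_dyadic_le hp1 hp2
  refine ⟨C, hC, fun J => ?_⟩
  let b : ℕ → ℝ := fun j => ((2 : ℝ) ^ j) ^ (-p)
  have hb0 : ∀ j, 0 < b j := fun j => by positivity
  let S := ∑ j : Fin (J + 1), b j
  have hSr : S = ∑ j ∈ Finset.range (J + 1), b j := Fin.sum_univ_eq_sum_range b (J + 1)
  have hS1 : 1 ≤ S := by
    have h := Finset.single_le_sum (f := fun j : Fin (J + 1) => b j) (fun j _ => (hb0 j).le)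
      (Finset.mem_univ 0)
    have : b ((0 : Fin (J + 1)) : ℕ) = 1 := by simp [b]
    simp only [this] at h
    exact h
  have hS2 : S ≤ 2 := by
    rw [hSr]
    have hle : ∀ j, b j ≤ (1 / 2) ^ j := by
      intro j
      have h1 : (1 : ℝ) ≤ 2 ^ j := one_le_pow₀ (by norm_num)
      calc b j ≤ ((2 : ℝ) ^ j) ^ (-1 : ℝ) := rpow_le_rpow_of_exponent_le h1 (by linarith)
        _ = (1 / 2) ^ j := by rw [rpow_neg_one, one_div, inv_pow]
    refine (Finset.sum_le_sum fun j _ => hle j).trans ?_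
    have := sum_geometric_two_le (J + 1)
    exact this
  have hS0 : 0 < S := by linarith
  have hqb : ∀ j, b j / S ≤ b j := fun j => div_le_self (hb0 j).le hS1
  have hq1 : ∑ j : Fin (J + 1), b j / S = 1 := by rw [← Finset.sum_div, div_self hS0.ne']
  refine ⟨fun j => b j / S, fun j => (div_pos (hb0 j) hS0).le, hq1, fun y hy => ?_,
    fun y hy hy1 hJ => ?_⟩
  · calc _ ≤ ∑ j : Fin (J + 1), b j * min ((y * 2 ^ (j : ℕ)) ^ 2) (y * 2 ^ (j : ℕ)) := by
          refine Finset.sum_le_sum fun j _ => ?_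
          have : 0 ≤ min ((y * 2 ^ (j : ℕ)) ^ 2) (y * 2 ^ (j : ℕ)) := by positivity
          gcongr
          exact hqb j
      _ = _ := Fin.sum_univ_eq_sum_range
          (fun j => b j * min ((y * 2 ^ j) ^ 2) (y * 2 ^ j)) (J + 1)
      _ ≤ _ := hmom y hy (J + 1)
  · rcases hy.eq_or_lt with rfl | hy0
    · simp [Real.zero_rpow (by linarith : p ≠ 0), hq1]
    -- A single level suffices: the first j with y 2^j ≥ 1 has y 2^j ≤ 2, hence mass at least y^p/8
    -- after normalisation, and there the exponential is at most 1/2. This gives 1/16.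
    have hex : ∃ j : ℕ, 1 ≤ y * 2 ^ j := ⟨J, hJ hy0.ne'⟩
    classical
    let j := Nat.find hex
    have hj1 : 1 ≤ y * 2 ^ j := Nat.find_spec hex
    have hjJ : j ≤ J := Nat.find_min' hex (hJ hy0.ne')
    have hj2 : y * 2 ^ j ≤ 2 := by
      rcases Nat.eq_zero_or_pos j with h0 | h0
      · rw [h0]; simp; linarith
      · have := Nat.find_min hex (show j - 1 < j by omega)
        push Not at this
        have e : (2 : ℝ) ^ j = 2 * 2 ^ (j - 1) := by
          rw [← pow_succ']; congr 1; omega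
        rw [e]; linarith
    have hbj : y ^ p / 4 ≤ b j := by
      have h1 : (2 : ℝ) ^ j ≤ 2 / y := by rw [le_div_iff₀ hy0]; linarith
      have h2 : (2 / y) ^ (-p) ≤ b j :=
        Real.rpow_le_rpow_of_nonpos (by positivity) h1 (by linarith)
      refine le_trans ?_ h2
      rw [div_rpow (by norm_num) hy, rpow_neg hy, div_inv_eq_mul, rpow_neg (by norm_num), mul_comm,
        div_eq_mul_inv]
      gcongr
      calc (2 : ℝ) ^ p ≤ 2 ^ (2 : ℝ) := rpow_le_rpow_of_exponent_le (by norm_num) hp2.le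
        _ = 4 := by norm_num
    have hexp : rexp (-(y * 2 ^ j) ^ 2) ≤ 1 / 2 := by
      have h1 : rexp (-(y * 2 ^ j) ^ 2) ≤ rexp (-1) := by
        gcongr
        exact one_le_pow₀ hj1
      have := Real.exp_neg_one_lt_half
      linarith
    have hsum : ∑ i : Fin (J + 1), b i / S * (1 - rexp (-(y * 2 ^ (i : ℕ)) ^ 2)) ≥
        b j / S * (1 - rexp (-(y * 2 ^ j) ^ 2)) := by
      refine Finset.single_le_sum (f := fun i : Fin (J + 1) =>
        b i / S * (1 - rexp (-(y * 2 ^ (i : ℕ)) ^ 2))) (fun i _ => ?_)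
        (Finset.mem_univ (⟨j, by omega⟩ : Fin (J + 1)))
      have h1 : rexp (-(y * 2 ^ (i : ℕ)) ^ 2) ≤ 1 := Real.exp_le_one_iff.2 (by
        have := sq_nonneg (y * 2 ^ (i : ℕ)); linarith)
      have := hb0 i
      have h2 : 0 ≤ 1 - rexp (-(y * 2 ^ (i : ℕ)) ^ 2) := by linarith
      positivity
    simp only [mul_sub, mul_one] at hsum
    rw [Finset.sum_sub_distrib, hq1] at hsum
    have hlow : y ^ p / 16 ≤ b j / S - b j / S * rexp (-(y * 2 ^ j) ^ 2) := by
      have h1 : y ^ p / 8 ≤ b j / S := by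
        rw [le_div_iff₀ hS0]
        have : 0 ≤ y ^ p := by positivity
        nlinarith
      have h2 : 0 ≤ b j / S := by have := hb0 j; positivity
      nlinarith
    have := Real.add_one_le_exp (-(y ^ p / 16))
    linarith

end HeavyTail

/-! ### Independent weights -/

section ProductWeights

/-- Let h be the term added to the bound for a coordinate t. As the bound is already at least M/2,
its square grows by at least Mh + h². This covers t², because Mh = t² for small t and h = t for
large t. Heavy-tailed coordinates thus enter only through a truncated moment. -/
theorem sqrt_sum_sq_le_add_sum_min {κ : Type*} [DecidableEq κ] (t : κ → ℝ) (ht : ∀ i, 0 ≤ t i) {M : ℝ} (hM : 0 < M)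
    (s : Finset κ) :
    √(∑ i ∈ s, t i ^ 2) ≤ M / 2 + ∑ i ∈ s, M * min ((t i / M) ^ 2) (t i / M) := by
  have hm0 : ∀ i, 0 ≤ M * min ((t i / M) ^ 2) (t i / M) := fun i => by
    have := ht i
    positivity
  induction s using Finset.induction_on with
  | empty => simp; positivity
  | insert a s ha ih =>
    rw [Finset.sum_insert ha, Finset.sum_insert ha]
    have hs0 : 0 ≤ ∑ i ∈ s, M * min ((t i / M) ^ 2) (t i / M) := Finset.sum_nonneg fun i _ => hm0 i
    set W := ∑ i ∈ s, M * min ((t i / M) ^ 2) (t i / M)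
    rw [Real.sqrt_le_left (by have := hm0 a; positivity)] at ih ⊢
    have h0 := hm0 a
    have h1 : t a ^ 2 ≤ M * (M * min ((t a / M) ^ 2) (t a / M)) +
        (M * min ((t a / M) ^ 2) (t a / M)) ^ 2 := by
      rcases min_choice ((t a / M) ^ 2) (t a / M) with h | h
      · rw [h]
        have : M * (M * (t a / M) ^ 2) = t a ^ 2 := by field_simp
        rw [this]
        nlinarith [sq_nonneg (M * (t a / M) ^ 2)]
      · rw [h]
        have : M * (t a / M) = t a := by field_simp
        rw [this]
        have := ht a
        nlinarith
    nlinarith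

variable {κ B : Type*} [Fintype κ] [DecidableEq κ] [Fintype B]

theorem sum_prod_weight_mul_prod (q : B → ℝ) (f : κ → B → ℝ) :
    ∑ ω : κ → B, (∏ i, q (ω i)) * ∏ i, f i (ω i) = ∏ i, ∑ b, q b * f i b := by
  have := Finset.prod_univ_sum (fun _ : κ => (Finset.univ : Finset B)) fun i b => q b * f i b
  rw [Fintype.piFinset_univ] at this
  rw [this]
  exact Finset.sum_congr rfl fun ω _ => Finset.prod_mul_distrib.symm

theorem sum_prod_weight {q : B → ℝ} (hq : ∑ b, q b = 1) : ∑ ω : κ → B, ∏ i, q (ω i) = 1 := by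
  have := sum_prod_weight_mul_prod (κ := κ) q fun _ _ => 1
  simpa [hq] using this

theorem sum_prod_weight_mul_apply {q : B → ℝ} (hq : ∑ b, q b = 1) (f : B → ℝ) (i₀ : κ) :
    ∑ ω : κ → B, (∏ i, q (ω i)) * f (ω i₀) = ∑ b, q b * f b := by
  have := sum_prod_weight_mul_prod (κ := κ) q fun i b => if i = i₀ then f b else 1
  simpa [Finset.prod_ite_eq', apply_ite, hq, Finset.sum_ite, mul_ite, Finset.prod_ite] using this

end ProductWeights

/-! ### Random diagonal maps from sequence spaces to Euclidean space -/

section DiagonalMaps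

open Real

/-- Random diagonal maps: on a set of `ω` of weight at least `1 / 2` they do not shrink given
vectors, and on average they do not expand vectors of `ℓ_p` by much. -/
theorem exists_random_diagonal {p : ℝ} (hp1 : 1 < p) (hp2 : p < 2) :
    ∃ C : ℝ, 0 < C ∧ ∀ {ι : Type*} (V : Finset ι) (D d : ℕ) (y : ι → Fin D → ℝ), 0 < d →
      (∀ v k, 0 ≤ y v k) → (∀ v ∈ V, ∀ k, y v k ≤ 1) → (∀ v ∈ V, 1 / 2 ≤ ∑ k, y v k ^ p) →
      64 * Real.log (2 * V.card) ≤ d →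
      ∃ (Ω : Type) (_ : Fintype Ω) (w : Ω → ℝ) (a : Ω → Fin d × Fin D → ℝ) (G : Finset Ω),
        (∀ ω, 0 ≤ w ω) ∧ (∀ ω i, 0 ≤ a ω i) ∧ 1 / 2 ≤ ∑ ω ∈ G, w ω ∧
        (∀ ω ∈ G, ∀ v ∈ V, (d : ℝ) / 64 ≤ ∑ i, (y v i.2 * a ω i) ^ 2) ∧
        ∀ (z : Fin D → ℝ) (s : ℝ), 0 < s → (∀ k, 0 ≤ z k) → ∑ k, z k ^ p ≤ s ^ p →
          ∑ ω, w ω * √(∑ i, (z i.2 * a ω i) ^ 2) ≤ C * (d : ℝ) ^ (1 / p) * s := by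
  classical
  obtain ⟨C, hC, hex⟩ := exists_heavyTail hp1 hp2
  refine ⟨1 / 2 + C, by positivity, ?_⟩
  intro ι V D d y hd hy0 hy1 hyp hdV
  -- The truncation level must reach the smallest nonzero coordinate. It depends on V, which is
  -- harmless because C does not depend on J.
  have hJ : ∃ J : ℕ, ∀ v ∈ V, ∀ k, y v k ≠ 0 → 1 ≤ y v k * 2 ^ J := by
    have : ∀ᶠ J : ℕ in Filter.atTop, ∀ v ∈ V, ∀ k, y v k ≠ 0 → 1 ≤ y v k * 2 ^ J := by
      refine (Filter.eventually_all_finset V).2 fun v _ => Filter.eventually_all.2 fun k => ?_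
      by_cases h : y v k = 0
      · exact Filter.Eventually.of_forall fun J h' => absurd h h'
      · have hpos : 0 < y v k := lt_of_le_of_ne (hy0 v k) (Ne.symm h)
        have ht := (tendsto_pow_atTop_atTop_of_one_lt (r := (2 : ℝ)) (by norm_num)).const_mul_atTop
          hpos
        exact (ht.eventually_ge_atTop 1).mono fun J hJ _ => hJ
    exact this.exists
  obtain ⟨J, hJ⟩ := hJ
  obtain ⟨q, hq0, hq1, hmom, hexp⟩ := hex J
  let Ω := Fin d × Fin D → Fin (J + 1)
  let w : Ω → ℝ := fun ω => ∏ i, q (ω i)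
  let a : Ω → Fin d × Fin D → ℝ := fun ω i => 2 ^ (ω i : ℕ)
  have hw0 : ∀ ω, 0 ≤ w ω := fun ω => Finset.prod_nonneg fun i _ => hq0 _
  have hw1 : ∑ ω, w ω = 1 := sum_prod_weight hq1
  let Y : ι → Ω → ℝ := fun v ω => ∑ i, (y v i.2 * a ω i) ^ 2
  have hY : ∀ v ∈ V, ∑ ω, w ω * rexp (-Y v ω) ≤ rexp (-(d / 32)) := by
    intro v hv
    have e : ∀ ω, w ω * rexp (-Y v ω) =
        (∏ i, q (ω i)) * ∏ i, rexp (-(y v i.2 * 2 ^ (ω i : ℕ)) ^ 2) := by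
      intro ω
      rw [← Real.exp_sum, Finset.sum_neg_distrib]
    simp only [e]
    rw [sum_prod_weight_mul_prod q fun (i : Fin d × Fin D) (j : Fin (J + 1)) =>
      rexp (-(y v i.2 * 2 ^ (j : ℕ)) ^ 2)]
    calc _ ≤ ∏ i : Fin d × Fin D, rexp (-(y v i.2 ^ p / 16)) := by
          refine Finset.prod_le_prod (fun i _ => Finset.sum_nonneg fun j _ =>
            mul_nonneg (hq0 j) (Real.exp_pos _).le) fun i _ => ?_
          exact hexp _ (hy0 v i.2) (hy1 v hv i.2) (hJ v hv i.2)
      _ = rexp (-(d * (∑ k, y v k ^ p) / 16)) := by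
          rw [← Real.exp_sum, Fintype.sum_prod_type]
          simp only [Finset.sum_neg_distrib, ← Finset.sum_div, Finset.sum_const, Finset.card_univ,
            Fintype.card_fin, nsmul_eq_mul]
      _ ≤ _ := by
          refine Real.exp_le_exp.2 ?_
          have h1 := hyp v hv
          have h2 : (0 : ℝ) ≤ d := Nat.cast_nonneg d
          nlinarith
  -- F ω ≤ 1 forces every Y v ω ≥ d/64. Since F has mean at most 1/2, Markov's inequality gives this
  -- event weight at least 1/2.
  let F : Ω → ℝ := fun ω => ∑ v ∈ V, rexp (d / 64 - Y v ω)
  have hF0 : ∀ ω, 0 ≤ F ω := fun ω => Finset.sum_nonneg fun _ _ => (Real.exp_pos _).le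
  have hF : ∑ ω, w ω * F ω ≤ 1 / 2 := by
    have e : ∑ ω, w ω * F ω = ∑ v ∈ V, rexp (d / 64) * ∑ ω, w ω * rexp (-Y v ω) := by
      simp only [F, Finset.mul_sum]
      rw [Finset.sum_comm]
      refine Finset.sum_congr rfl fun v _ => Finset.sum_congr rfl fun ω _ => ?_
      rw [sub_eq_add_neg, Real.exp_add]
      ring
    rw [e]
    calc _ ≤ ∑ v ∈ V, rexp (d / 64) * rexp (-(d / 32)) := by
          refine Finset.sum_le_sum fun v hv => ?_
          gcongr
          exact hY v hv
      _ = V.card * rexp (-(d / 64)) := by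
          rw [Finset.sum_const, nsmul_eq_mul, ← Real.exp_add]
          congr 2
          ring
      _ ≤ 1 / 2 := by
          rcases V.eq_empty_or_nonempty with rfl | hV
          · simp
          have hpos : (0 : ℝ) < 2 * V.card := by
            have := hV.card_pos
            positivity
          have : (2 * V.card : ℝ) ≤ rexp (d / 64) := by
            rw [← Real.log_le_iff_le_exp hpos]
            linarith
          rw [Real.exp_neg, ← div_eq_mul_inv, div_le_div_iff₀ (Real.exp_pos _) (by norm_num)]
          linarith
  refine ⟨Ω, inferInstance, w, a, Finset.univ.filter fun ω => F ω ≤ 1, hw0,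
    fun ω i => by positivity, ?_, ?_, ?_⟩
  · have h1 : ∑ ω ∈ Finset.univ.filter (fun ω => ¬ F ω ≤ 1), w ω ≤ ∑ ω, w ω * F ω := by
      refine le_trans (Finset.sum_le_sum fun ω hω => ?_) (Finset.sum_le_sum_of_subset_of_nonneg
        (Finset.filter_subset (fun ω => ¬ F ω ≤ 1) _) fun ω _ _ => mul_nonneg (hw0 ω) (hF0 ω))
      rw [Finset.mem_filter, not_le] at hω
      exact le_mul_of_one_le_right (hw0 ω) hω.2.le
    have h2 := Finset.sum_filter_add_sum_filter_not Finset.univ (fun ω => F ω ≤ 1) w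
    linarith
  · intro ω hω v hv
    have h1 := (Finset.mem_filter.1 hω).2
    have h2 := (Finset.single_le_sum (f := fun v => rexp (d / 64 - Y v ω))
      (fun _ _ => (Real.exp_pos _).le) hv).trans h1
    rw [Real.exp_le_one_iff] at h2
    change _ ≤ Y v ω
    linarith
  · intro z s hs hz hzs
    have hd' : (0 : ℝ) < d := by exact_mod_cast hd
    -- The scale at which the truncated moments, each at most C (z k / M)^p, add up to at most C
    -- over the d copies.
    set M := (d : ℝ) ^ (1 / p) * s with hM'
    have hM : 0 < M := by positivity
    have hMp : M ^ p = d * s ^ p := by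
      rw [hM', mul_rpow (by positivity) hs.le, ← rpow_mul hd'.le, one_div,
        inv_mul_cancel₀ (by linarith), rpow_one]
    have hle : ∀ ω, √(∑ i, (z i.2 * a ω i) ^ 2) ≤ M / 2 + ∑ i : Fin d × Fin D,
        M * min ((z i.2 / M * 2 ^ (ω i : ℕ)) ^ 2) (z i.2 / M * 2 ^ (ω i : ℕ)) := by
      intro ω
      have := sqrt_sum_sq_le_add_sum_min (fun i : Fin d × Fin D => z i.2 * a ω i)
        (fun i => mul_nonneg (hz _) (by positivity)) hM Finset.univ
      simpa only [a, mul_div_right_comm] using this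
    calc ∑ ω, w ω * √(∑ i, (z i.2 * a ω i) ^ 2)
        ≤ ∑ ω, w ω * (M / 2 + ∑ i : Fin d × Fin D,
          M * min ((z i.2 / M * 2 ^ (ω i : ℕ)) ^ 2) (z i.2 / M * 2 ^ (ω i : ℕ))) :=
          Finset.sum_le_sum fun ω _ => mul_le_mul_of_nonneg_left (hle ω) (hw0 ω)
      _ = M / 2 + ∑ i : Fin d × Fin D, M * ∑ ω, w ω *
          min ((z i.2 / M * 2 ^ (ω i : ℕ)) ^ 2) (z i.2 / M * 2 ^ (ω i : ℕ)) := by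
          simp only [mul_add, Finset.sum_add_distrib, ← Finset.sum_mul, hw1, one_mul,
            Finset.mul_sum]
          rw [Finset.sum_comm]
          congr 1
          exact Finset.sum_congr rfl fun i _ => Finset.sum_congr rfl fun ω _ => by ring
      _ ≤ M / 2 + ∑ i : Fin d × Fin D, M * (C * (z i.2 / M) ^ p) := by
          gcongr with i
          rw [sum_prod_weight_mul_apply hq1 (fun j : Fin (J + 1) =>
            min ((z i.2 / M * 2 ^ (j : ℕ)) ^ 2) (z i.2 / M * 2 ^ (j : ℕ))) i]
          exact hmom _ (div_nonneg (hz _) hM.le)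
      _ = M / 2 + M * C * (d * (∑ k, z k ^ p) / M ^ p) := by
          rw [Fintype.sum_prod_type]
          simp only [div_rpow (hz _) hM.le, ← Finset.mul_sum, ← Finset.sum_div, Finset.sum_const,
            Finset.card_univ, Fintype.card_fin, nsmul_eq_mul]
          ring
      _ ≤ M / 2 + M * C * 1 := by
          gcongr
          rw [hMp, div_le_one (by positivity)]
          gcongr
      _ = _ := by rw [hM']; ring

/-- Finitely many coordinates carry half of the p-th power of each norm. Their number D enters no
later estimate. -/
theorem exists_forall_half_norm_rpow_le {p : ℝ≥0∞} [Fact (1 ≤ p)] (hp : 0 < p.toReal)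
    (W : Finset (ell p)) : ∃ D : ℕ, ∀ v ∈ W,
      1 / 2 * ‖v‖ ^ p.toReal ≤ ∑ k : Fin D, |v k| ^ p.toReal := by
  have : ∀ᶠ D : ℕ in Filter.atTop, ∀ v ∈ W,
      1 / 2 * ‖v‖ ^ p.toReal ≤ ∑ k : Fin D, |v k| ^ p.toReal := by
    refine (Filter.eventually_all_finset W).2 fun v _ => ?_
    by_cases hv : v = 0
    · refine Filter.Eventually.of_forall fun D => ?_
      simp only [hv, norm_zero, zero_rpow hp.ne', mul_zero]
      exact Finset.sum_nonneg fun _ _ => by positivity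
    · have hpos : 0 < ‖v‖ ^ p.toReal := rpow_pos_of_pos (norm_pos_iff.2 hv) _
      refine ((lp.hasSum_norm hp v).tendsto_sum_nat.eventually_const_le
        (show 1 / 2 * ‖v‖ ^ p.toReal < ‖v‖ ^ p.toReal by linarith)).mono fun D hD => ?_
      rw [Fin.sum_univ_eq_sum_range (fun k => |v k| ^ p.toReal) D]
      exact hD
  exact this.exists

/-- The map `x ↦ (x k * a (i, k))` from `ℓ_p` to a Euclidean space. -/
noncomputable def diagMap (p : ℝ≥0∞) {d D : ℕ} (a : Fin d × Fin D → ℝ) (x : ell p) :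
    EuclideanSpace ℝ (Fin d × Fin D) :=
  WithLp.toLp 2 fun i => x i.2 * a i

theorem dist_diagMap {p : ℝ≥0∞} {d D : ℕ} (a : Fin d × Fin D → ℝ) (x y : ell p) :
    dist (diagMap p a x) (diagMap p a y) = √(∑ i, (|(x - y) i.2| * a i) ^ 2) := by
  rw [EuclideanSpace.dist_eq]
  congr 1
  refine Finset.sum_congr rfl fun i _ => ?_
  have e : (x - y) i.2 = x i.2 - y i.2 := rfl
  rw [e, mul_pow, sq_abs, Real.dist_eq, sq_abs, ← mul_pow, sub_mul]
  rfl

theorem norm_le_mul_dist_diagMap {p : ℝ≥0∞} {d D : ℕ} (hd : 0 < d) (a : Fin d × Fin D → ℝ)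
    (x y : ell p) {r : ℝ} (hr : 0 < r) (h : (d : ℝ) / 64 ≤ ∑ i, (|(x - y) i.2| / r * a i) ^ 2) :
    r ≤ 8 / √d * dist (diagMap p a x) (diagMap p a y) := by
  have hd' : (0 : ℝ) < d := by exact_mod_cast hd
  have e : ∑ i, (|(x - y) i.2| / r * a i) ^ 2 = (∑ i, (|(x - y) i.2| * a i) ^ 2) / r ^ 2 := by
    rw [Finset.sum_div]
    exact Finset.sum_congr rfl fun i _ => by rw [div_mul_eq_mul_div, div_pow]
  rw [e, le_div_iff₀ (by positivity)] at h
  have h2 := Real.sqrt_le_sqrt h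
  rw [← dist_diagMap, Real.sqrt_mul (by positivity), Real.sqrt_sq hr.le, Real.sqrt_div hd'.le,
    show (64 : ℝ) = 8 ^ 2 by norm_num, Real.sqrt_sq (by norm_num)] at h2
  rw [div_mul_eq_mul_div, le_div_iff₀ (by positivity)]
  linarith

theorem exists_random_map_ell {p : ℝ≥0∞} [Fact (1 ≤ p)] (hp1 : 1 < p.toReal)
    (hp2 : p.toReal < 2) :
    ∃ C : ℝ, 0 < C ∧ ∀ (N : Finset (ell p)) (m d : ℕ), N.card ≤ m → 0 < d →
      64 * Real.log (2 * m ^ 2) ≤ d →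
      ∃ (D : ℕ) (Ω : Type) (_ : Fintype Ω) (w : Ω → ℝ) (G : Finset Ω)
        (S : Ω → ell p → EuclideanSpace ℝ (Fin d × Fin D)),
        (∀ ω, 0 ≤ w ω) ∧ 1 / 2 ≤ ∑ ω ∈ G, w ω ∧
        (∀ ω ∈ G, ∀ x ∈ N, ∀ y ∈ N, dist x y ≤ 8 / √d * dist (S ω x) (S ω y)) ∧
        ∀ x y, ∑ ω, w ω * dist (S ω x) (S ω y) ≤ C * (d : ℝ) ^ (1 / p.toReal) * dist x y := by
  classical
  obtain ⟨C, hC, hdiag⟩ := exists_random_diagonal hp1 hp2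
  have hp0 : 0 < p.toReal := by linarith
  refine ⟨C, hC, fun N m d hN hd hdm => ?_⟩
  let V : Finset (ell p × ell p) := (N ×ˢ N).filter fun v => v.1 ≠ v.2
  obtain ⟨D, hD⟩ := exists_forall_half_norm_rpow_le hp0 (V.image fun v => v.1 - v.2)
  have hVpos : ∀ v ∈ V, 0 < ‖v.1 - v.2‖ := fun v hv =>
    norm_pos_iff.2 (sub_ne_zero.2 (Finset.mem_filter.1 hv).2)
  have hpne : p ≠ 0 := by
    rintro rfl
    simp at hp0
  have hcard : 64 * Real.log (2 * V.card) ≤ d := by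
    refine le_trans ?_ hdm
    rcases Nat.eq_zero_or_pos V.card with h0 | h0
    · rw [h0]
      simp only [Nat.cast_zero, mul_zero, Real.log_zero]
      have : (2 * m ^ 2 : ℝ) = ((2 * m ^ 2 : ℕ) : ℝ) := by push_cast; ring
      rw [this]
      have := Real.log_natCast_nonneg (2 * m ^ 2)
      positivity
    · gcongr
      have h1 : V.card ≤ N.card ^ 2 := by
        have := Finset.card_filter_le (N ×ˢ N) fun q => q.1 ≠ q.2
        rwa [Finset.card_product, ← sq] at this
      have h2 : N.card ^ 2 ≤ m ^ 2 := Nat.pow_le_pow_left hN 2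
      exact_mod_cast h1.trans h2
  obtain ⟨Ω, hΩ, w, a, G, hw0, ha0, hG, hlow, hup⟩ := hdiag V D d
    (fun v k => |(v.1 - v.2) k| / ‖v.1 - v.2‖) hd (fun v k => by positivity)
    (fun v hv k => by
      rw [div_le_one (hVpos v hv)]
      exact lp.norm_apply_le_norm hpne (v.1 - v.2) k)
    (fun v hv => by
      have h1 := hD _ (Finset.mem_image_of_mem _ hv)
      have hpos := hVpos v hv
      simp only [div_rpow (abs_nonneg _) hpos.le, ← Finset.sum_div]
      rwa [le_div_iff₀ (by positivity)]) hcard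
  refine ⟨D, Ω, hΩ, w, G, fun ω => diagMap p (a ω), hw0, hG, fun ω hω x hx y hy => ?_,
    fun x y => ?_⟩
  · by_cases hxy : x = y
    · simp [hxy]
    have hv : (x, y) ∈ V := Finset.mem_filter.2 ⟨Finset.mem_product.2 ⟨hx, hy⟩, hxy⟩
    rw [dist_eq_norm x y]
    have h1 := hlow ω hω _ hv
    have h2 := hVpos _ hv
    beta_reduce at h1
    exact norm_le_mul_dist_diagMap hd (a ω) x y h2 h1
  · by_cases hxy : x = y
    · simp [hxy]
    have hpos : 0 < ‖x - y‖ := norm_pos_iff.2 (sub_ne_zero.2 hxy)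
    simp only [dist_diagMap]
    rw [dist_eq_norm x y]
    refine hup (fun k => |(x - y) k|) ‖x - y‖ hpos (fun k => abs_nonneg _) ?_
    rw [Fin.sum_univ_eq_sum_range (fun k => |(x - y) k| ^ p.toReal) D]
    exact sum_le_hasSum _ (fun k _ => by positivity) (lp.hasSum_norm hp0 (x - y))

/-- Each good ω yields an extension of the same φ, so their weighted average also extends φ.
Noncontraction must hold for all pairs at once for each good ω, but expansion is needed only in the
mean: the factors 8/√d and C d^(1/p) multiply, and normalising by the weight of G costs 2. -/
theorem finExt_ell_of_finExt_euclidean {p : ℝ≥0∞} [Fact (1 ≤ p)] (hp1 : 1 < p.toReal)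
    (hp2 : p.toReal < 2) :
    ∃ C : ℝ, 0 < C ∧ ∀ (Z : Type*) [NormedAddCommGroup Z] [NormedSpace ℝ Z] (m d : ℕ) (B : ℝ),
      0 ≤ B → (∀ D : ℕ, FinExt (EuclideanSpace ℝ (Fin d × Fin D)) Z m B) → 0 < d →
      64 * Real.log (2 * m ^ 2) ≤ d →
      FinExt (ell p) Z m (C * B * (d : ℝ) ^ (1 / p.toReal - 1 / 2)) := by
  classical
  obtain ⟨C, hC, hmap⟩ := exists_random_map_ell hp1 hp2
  refine ⟨16 * C, by positivity, fun Z _ _ m d B hB hE hd hdm => ?_⟩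
  intro T N φ L hT hTN hN hL hφ
  have hd' : (0 : ℝ) < d := by exact_mod_cast hd
  obtain ⟨D, Ω, _, w, G, S, hw0, hG, hlow, hup⟩ := hmap N m d hN hd hdm
  have hΨ : ∀ ω, ∃ Ψ : ell p → Z, ω ∈ G → (∀ t ∈ T, Ψ t = φ t) ∧ ∀ x ∈ N, ∀ y ∈ N,
      dist (Ψ x) (Ψ y) ≤ B * (8 / √d * L) * dist (S ω x) (S ω y) := by
    intro ω
    by_cases hω : ω ∈ G
    · obtain ⟨Ψ, h⟩ := (hE D).pullback hT hTN hN hL (by positivity) hφ (S ω) (hlow ω hω)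
      exact ⟨Ψ, fun _ => h⟩
    · exact ⟨φ, fun h => absurd h hω⟩
  choose Ψ hΨ using hΨ
  set w₀ := ∑ ω ∈ G, w ω with hw₀
  have hw₀pos : 0 < w₀ := by linarith
  refine ⟨fun x => w₀⁻¹ • ∑ ω ∈ G, w ω • Ψ ω x, fun t ht => ?_, fun x hx y hy => ?_⟩
  · have : ∑ ω ∈ G, w ω • Ψ ω t = w₀ • φ t := by
      rw [hw₀, Finset.sum_smul]
      exact Finset.sum_congr rfl fun ω hω => by rw [(hΨ ω hω).1 t ht]
    simp only [this]
    rw [inv_smul_smul₀ hw₀pos.ne']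
  · have hinv : w₀⁻¹ ≤ 2 := by
      rw [inv_le_comm₀ hw₀pos (by norm_num)]
      linarith
    rw [dist_eq_norm, ← smul_sub, ← Finset.sum_sub_distrib, norm_smul,
      Real.norm_of_nonneg (by positivity)]
    have hsum : ‖∑ ω ∈ G, (w ω • Ψ ω x - w ω • Ψ ω y)‖ ≤
        B * (8 / √d * L) * (C * (d : ℝ) ^ (1 / p.toReal) * dist x y) := by
      calc _ ≤ ∑ ω ∈ G, w ω * (B * (8 / √d * L) * dist (S ω x) (S ω y)) := by
            refine norm_sum_le_of_le _ fun ω hω => ?_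
            rw [← smul_sub, norm_smul, Real.norm_of_nonneg (hw0 ω), ← dist_eq_norm]
            exact mul_le_mul_of_nonneg_left ((hΨ ω hω).2 x hx y hy) (hw0 ω)
        _ ≤ ∑ ω, w ω * (B * (8 / √d * L) * dist (S ω x) (S ω y)) :=
            Finset.sum_le_sum_of_subset_of_nonneg (Finset.subset_univ _) fun ω _ _ =>
              mul_nonneg (hw0 ω) (by positivity)
        _ = B * (8 / √d * L) * ∑ ω, w ω * dist (S ω x) (S ω y) := by
            rw [Finset.mul_sum]
            exact Finset.sum_congr rfl fun ω _ => by ring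
        _ ≤ _ := by
            gcongr
            exact hup x y
    calc _ ≤ 2 * (B * (8 / √d * L) * (C * (d : ℝ) ^ (1 / p.toReal) * dist x y)) := by gcongr
      _ = _ := by
        rw [rpow_sub hd', ← Real.sqrt_eq_rpow]
        ring

end DiagonalMaps

/-! ### Choice of parameters and the five bounds -/

theorem lipExtAdd_le_ofReal {M Z : Type*} [MetricSpace M] [MetricSpace Z] [Nonempty Z]
    {n : ℕ} {K B : ℝ} (h : FinExt M Z (2 * n) K) (hK : 0 ≤ K) (hB : 2 * K + 5 ≤ B) :
    lipExtAdd n M Z ≤ ENNReal.ofReal B :=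
  (lipExtAdd_le_of_finExt (by linarith) (h.mono (by linarith : K ≤ K + 1))).trans
    (ENNReal.ofReal_le_ofReal (by linarith))

theorem one_le_log_of_three_le {n : ℕ} (hn : 3 ≤ n) : 1 < Real.log n := by
  rw [Real.lt_log_iff_exp_lt (by positivity)]
  have h1 := Real.exp_one_lt_d9
  have h2 : (3 : ℝ) ≤ n := by exact_mod_cast hn
  linarith

theorem exists_dimension {n : ℕ} (hn : 3 ≤ n) :
    ∃ d : ℕ, 0 < d ∧ 64 * Real.log (2 * ((2 * n : ℕ) : ℝ) ^ 2) ≤ d ∧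
      10 * Real.log (2 * ((2 * n : ℕ) : ℝ) ^ 2) < d ∧ (d : ℝ) ≤ 257 * Real.log n := by
  have hl := one_le_log_of_three_le hn
  have hn3 : (3 : ℝ) ≤ n := by exact_mod_cast hn
  have h1 : Real.log (2 * ((2 * n : ℕ) : ℝ) ^ 2) ≤ 4 * Real.log n := by
    have : (4 : ℝ) * Real.log n = Real.log ((n : ℝ) ^ 4) := by rw [Real.log_pow]; norm_num
    rw [this]
    push_cast
    gcongr
    have h9 : (9 : ℝ) ≤ (n : ℝ) ^ 2 := by nlinarith
    nlinarith
  have h2 := Nat.le_ceil (256 * Real.log n)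
  have h3 := Nat.ceil_lt_add_one (show 0 ≤ 256 * Real.log n by linarith)
  -- 256 = 64 · 4, as 2(2n)² ≤ n⁴ for n ≥ 3; rounding up is absorbed by log n > 1.
  refine ⟨⌈256 * Real.log n⌉₊, Nat.ceil_pos.2 (by linarith), by linarith, by linarith, by linarith⟩

theorem sqrt_le_mul_sqrt_log {d n : ℕ} (h : (d : ℝ) ≤ 257 * Real.log n) :
    √d ≤ 17 * √(Real.log n) := by
  calc √d ≤ √(17 ^ 2 * Real.log n) := by
        have := Real.log_natCast_nonneg n
        exact Real.sqrt_le_sqrt (by linarith)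
    _ = _ := by rw [Real.sqrt_mul (by positivity), Real.sqrt_sq (by norm_num)]

theorem finExt_banach_of_inner (E : Type*) [NormedAddCommGroup E] [InnerProductSpace ℝ E]
    (Z : Type*) [NormedAddCommGroup Z] [NormedSpace ℝ Z] [CompleteSpace Z] {n : ℕ} (hn : 3 ≤ n) :
    FinExt E Z (2 * n) (30600 * √(Real.log n)) := by
  obtain ⟨d, hd, -, hdJ, hdn⟩ := exists_dimension hn
  have hsd := sqrt_le_mul_sqrt_log hdn
  intro T N φ L hT hTN hN hL hφ
  have hNpos : (0 : ℝ) < N.card := by exact_mod_cast (hT.mono hTN).card_pos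
  have hN' : (N.card : ℝ) ≤ ((2 * n : ℕ) : ℝ) := by exact_mod_cast hN
  obtain ⟨g, hg⟩ := exists_dimension_reduction N hd (lt_of_le_of_lt (by gcongr) hdJ)
  have hext := finExt_finrank (EuclideanSpace ℝ (Fin d)) (by simpa using hd) Z (2 * n)
  rw [finrank_euclideanSpace_fin] at hext
  obtain ⟨Φ, h1, h2⟩ := hext.pullback hT hTN hN hL (by norm_num : (0 : ℝ) ≤ 3) hφ g
    fun x hx y hy => (hg x hx y hy).1
  refine ⟨Φ, h1, fun x hx y hy => (h2 x hx y hy).trans ?_⟩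
  calc _ ≤ 300 * (17 * √(Real.log n)) * (3 * L) * (2 * dist x y) := by
        gcongr
        exact (hg x hx y hy).2
    _ = _ := by ring

theorem finExt_inner_target (M : Type*) [MetricSpace M] (F : Type*) [NormedAddCommGroup F]
    [InnerProductSpace ℝ F] {n : ℕ} (hn : 3 ≤ n) :
    FinExt M F (2 * n) (102 * √(Real.log n)) := by
  classical
  obtain ⟨d, hd, -, hdJ, hdn⟩ := exists_dimension hn
  have hsd := sqrt_le_mul_sqrt_log hdn
  intro T N φ L hT hTN hN hL hφ
  have hTpos : (0 : ℝ) < (T.image φ).card := by exact_mod_cast (hT.image φ).card_pos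
  have hT' : ((T.image φ).card : ℝ) ≤ ((2 * n : ℕ) : ℝ) := by
    exact_mod_cast Finset.card_image_le.trans ((Finset.card_le_card hTN).trans hN)
  obtain ⟨g, hg⟩ := exists_dimension_reduction (T.image φ) hd (lt_of_le_of_lt (by gcongr) hdJ)
  -- McShane extension of each coordinate of the compressed map; reassembling d coordinates in the
  -- Euclidean norm costs √d.
  have hcoord : ∀ i : Fin d, ∃ h : M → ℝ, LipschitzWith (2 * L).toNNReal h ∧
      Set.EqOn (fun t => g (φ t) i) h T := by
    intro i
    refine LipschitzOnWith.extend_real (LipschitzOnWith.of_dist_le_mul fun s hs t ht => ?_)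
    rw [Real.coe_toNNReal _ (by positivity)]
    have h1 : dist (g (φ s) i) (g (φ t) i) ≤ dist (g (φ s)) (g (φ t)) := by
      have := PiLp.norm_apply_le (g (φ s) - g (φ t)) i
      rwa [← dist_eq_norm] at this
    have h2 := (hg _ (Finset.mem_image_of_mem φ hs) _ (Finset.mem_image_of_mem φ ht)).2
    have h3 := hφ s hs t ht
    linarith
  choose h hLip hEq using hcoord
  let H : M → EuclideanSpace ℝ (Fin d) := fun x => WithLp.toLp 2 fun i => h i x
  have hHT : ∀ t ∈ T, H t = g (φ t) := by
    intro t ht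
    ext i
    exact (hEq i ht).symm
  have hH : ∀ x y, dist (H x) (H y) ≤ √d * (2 * L * dist x y) := by
    intro x y
    rw [EuclideanSpace.dist_eq, ← Real.sqrt_sq (show 0 ≤ 2 * L * dist x y by positivity),
      ← Real.sqrt_mul (Nat.cast_nonneg d)]
    refine Real.sqrt_le_sqrt ?_
    calc _ ≤ ∑ i : Fin d, (2 * L * dist x y) ^ 2 := by
          gcongr with i
          have := (hLip i).dist_le_mul x y
          rwa [Real.coe_toNNReal _ (by positivity)] at this
      _ = _ := by simp
  have hinj : Set.InjOn g (T.image φ : Finset F) := by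
    intro a ha b hb hab
    have := (hg a ha b hb).1
    rw [hab, dist_self, mul_zero] at this
    exact dist_le_zero.1 this
  let f := Function.invFunOn g ((T.image φ : Finset F) : Set F)
  have hf : ∀ t ∈ T, f (H t) = φ t := by
    intro t ht
    rw [hHT t ht]
    exact hinj.leftInvOn_invFunOn (Finset.mem_coe.2 (Finset.mem_image_of_mem φ ht))
  -- The inverse of the compression is 3-Lipschitz on the compressed points; Kirszbraun extends it,
  -- with no further loss, to the images of the added points.
  obtain ⟨Ψ, h1, h2⟩ := finExt_inner (EuclideanSpace ℝ (Fin d)) F (2 * n) (T.image H) (N.image H) f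
    3 (hT.image H) (Finset.image_subset_image hTN) (Finset.card_image_le.trans hN) (by norm_num) (by
      intro a ha b hb
      obtain ⟨s, hs, rfl⟩ := Finset.mem_image.1 ha
      obtain ⟨t, ht, rfl⟩ := Finset.mem_image.1 hb
      rw [hf s hs, hf t ht, hHT s hs, hHT t ht]
      exact (hg _ (Finset.mem_image_of_mem φ hs) _ (Finset.mem_image_of_mem φ ht)).1)
  refine ⟨Ψ ∘ H, fun t ht => ?_, fun x hx y hy => ?_⟩
  · exact (h1 _ (Finset.mem_image_of_mem H ht)).trans (hf t ht)
  · refine (h2 _ (Finset.mem_image_of_mem H hx) _ (Finset.mem_image_of_mem H hy)).trans ?_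
    calc _ ≤ 1 * 3 * (17 * √(Real.log n) * (2 * L * dist x y)) := by
          gcongr
          exact (hH x y).trans (by gcongr)
      _ = _ := by ring

theorem lipExtAdd_le_log_div_loglog {n : ℕ} (hn : 3 ≤ n) (M : Type*) [MetricSpace M]
    (Z : Type*) [NormedAddCommGroup Z] [NormedSpace ℝ Z] [CompleteSpace Z] :
    lipExtAdd n M Z ≤ ENNReal.ofReal (2000 * (Real.log n / Real.log (Real.log n))) := by
  have hl := one_le_log_of_three_le hn
  have hn3 : (3 : ℝ) ≤ n := by exact_mod_cast hn
  have hlog2 : Real.log ((2 * n : ℕ) : ℝ) ≤ 2 * Real.log n := by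
    push_cast
    rw [Real.log_mul (by norm_num) (by positivity)]
    have : Real.log 2 ≤ Real.log n := by gcongr; linarith
    linarith
  set l := Real.log n
  have hll : 0 < Real.log l := Real.log_pos hl
  have hs1 : 1 ≤ √l := Real.one_le_sqrt.2 hl.le
  have hss : √l * √l = l := Real.mul_self_sqrt (by linarith)
  have hlogs : Real.log √l = Real.log l / 2 := Real.log_sqrt (by linarith)
  -- With R = 2 + √l, log R is at least half of log l, while R itself stays of order at most l / log
  -- l, so neither term of the averaging bound exceeds the target.
  have hsl : √l ≤ 2 * (l / Real.log l) := by
    have := Real.log_le_sub_one_of_pos (show 0 < √l by linarith)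
    rw [hlogs] at this
    rw [← mul_div_assoc, le_div_iff₀ hll]
    nlinarith
  have hlogR : Real.log l / 2 ≤ Real.log (2 + √l) := by
    rw [← hlogs]
    exact Real.log_le_log (by linarith) (by linarith)
  have hratio : Real.log ((2 * n : ℕ) : ℝ) / Real.log (2 + √l) ≤ 4 * (l / Real.log l) := by
    calc _ ≤ 2 * l / (Real.log l / 2) := by gcongr
      _ = _ := by field_simp; norm_num
  have h0 : 0 ≤ Real.log ((2 * n : ℕ) : ℝ) / Real.log (2 + √l) :=
    div_nonneg (Real.log_natCast_nonneg _) (by linarith)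
  exact lipExtAdd_le_ofReal (finExt_of_log_ratio M Z (2 * n) (by linarith : 2 ≤ 2 + √l))
    (by linarith) (by linarith)

theorem ell_cases {p : ℝ≥0∞} (hp1 : 1 < p) (hp2 : p ≤ 2) :
    p = 2 ∨ (1 < p.toReal ∧ p.toReal < 2) := by
  rcases hp2.eq_or_lt with h | h
  · exact Or.inl h
  · have htop : p ≠ ∞ := (h.trans (by simp)).ne
    refine Or.inr ⟨?_, ?_⟩
    · have := (ENNReal.toReal_lt_toReal (by simp) htop).2 hp1
      simpa using this
    · have := (ENNReal.toReal_lt_toReal htop (by simp)).2 h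
      simpa using this

theorem lipExtAdd_ell_two_banach {n : ℕ} (hn : 3 ≤ n) (Z : Type*) [NormedAddCommGroup Z]
    [NormedSpace ℝ Z] [CompleteSpace Z] :
    lipExtAdd n (ell 2) Z ≤ ENNReal.ofReal (70000 * √(Real.log n)) := by
  have hs1 : 1 ≤ √(Real.log n) := Real.one_le_sqrt.2 (one_le_log_of_three_le hn).le
  exact lipExtAdd_le_ofReal (finExt_banach_of_inner (ell 2) Z hn) (by positivity) (by linarith)

theorem rpow_dimension_le {d n : ℕ} {e : ℝ} (he : 0 ≤ e) (h : (d : ℝ) ≤ 257 * Real.log n) :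
    (d : ℝ) ^ e ≤ 257 ^ e * Real.log n ^ e := by
  rw [← Real.mul_rpow (by norm_num) (Real.log_natCast_nonneg n)]
  gcongr

theorem exists_lipExtAdd_ell_two_target {p : ℝ≥0∞} [Fact (1 ≤ p)] (hp1 : 1 < p) (hp2 : p ≤ 2) :
    ∃ c : ℝ, 0 < c ∧ ∀ n : ℕ, 3 ≤ n → lipExtAdd n (ell p) (ell 2) ≤
      ENNReal.ofReal (c * Real.log n ^ (1 / p.toReal - 1 / 2)) := by
  rcases ell_cases hp1 hp2 with rfl | ⟨h1, h2⟩
  · refine ⟨7, by norm_num, fun n hn => ?_⟩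
    refine lipExtAdd_le_ofReal (finExt_inner (ell 2) (ell 2) (2 * n)) zero_le_one ?_
    norm_num
  · obtain ⟨C, hC, h⟩ := finExt_ell_of_finExt_euclidean (p := p) h1 h2
    have he : 0 ≤ 1 / p.toReal - 1 / 2 := by
      rw [sub_nonneg]
      exact one_div_le_one_div_of_le (by linarith) h2.le
    set e := 1 / p.toReal - 1 / 2
    refine ⟨2 * (C * 257 ^ e) + 5, by positivity, fun n hn => ?_⟩
    obtain ⟨d, hd, hd64, -, hdn⟩ := exists_dimension hn
    have hE := h (ell 2) (2 * n) d 1 zero_le_one (fun D => finExt_inner _ _ _) hd hd64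
    have hle := rpow_dimension_le he hdn
    have h1 : 1 ≤ Real.log n ^ e := Real.one_le_rpow (one_le_log_of_three_le hn).le he
    refine lipExtAdd_le_ofReal hE (by positivity) ?_
    have := mul_le_mul_of_nonneg_left hle hC.le
    linarith

theorem exists_lipExtAdd_ell_banach {p : ℝ≥0∞} [Fact (1 ≤ p)] (hp1 : 1 < p) (hp2 : p ≤ 2) :
    ∃ c : ℝ, 0 < c ∧ ∀ n : ℕ, 3 ≤ n →
      ∀ (Z : Type*) [NormedAddCommGroup Z] [NormedSpace ℝ Z] [CompleteSpace Z],
        lipExtAdd n (ell p) Z ≤ ENNReal.ofReal (c * Real.log n ^ (1 / p.toReal)) := by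
  rcases ell_cases hp1 hp2 with rfl | ⟨h1, h2⟩
  · refine ⟨70000, by norm_num, fun n hn Z _ _ _ => ?_⟩
    have := lipExtAdd_ell_two_banach hn Z
    rwa [Real.sqrt_eq_rpow] at this
  · obtain ⟨C, hC, h⟩ := finExt_ell_of_finExt_euclidean (p := p) h1 h2
    have he : 0 ≤ 1 / p.toReal - 1 / 2 := by
      rw [sub_nonneg]
      exact one_div_le_one_div_of_le (by linarith) h2.le
    have hsplit : 1 / p.toReal = 1 / 2 + (1 / p.toReal - 1 / 2) := by ring
    rw [hsplit]
    set e := 1 / p.toReal - 1 / 2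
    refine ⟨2 * (C * 30600 * 257 ^ e) + 5, by positivity, fun n hn Z _ _ _ => ?_⟩
    obtain ⟨d, hd, hd64, -, hdn⟩ := exists_dimension hn
    have hl := one_le_log_of_three_le hn
    have hE := h Z (2 * n) d (30600 * √(Real.log n)) (by positivity)
      (fun D => finExt_banach_of_inner _ _ hn) hd hd64
    have hle := rpow_dimension_le he hdn
    have h1 : 1 ≤ Real.log n ^ (1 / 2 + e) := Real.one_le_rpow hl.le (by linarith)
    refine lipExtAdd_le_ofReal hE (by positivity) ?_
    have hk : 0 ≤ C * (30600 * √(Real.log n)) := by positivity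
    have := mul_le_mul_of_nonneg_left hle hk
    rw [Real.rpow_add (by linarith), ← Real.sqrt_eq_rpow] at h1 ⊢
    linarith

theorem mainTheorem2 :
    (∃ K : ℝ, 0 < K ∧ ∀ n : ℕ, 3 ≤ n →
      ∀ (M : Type*) [MetricSpace M]
        (Z : Type*) [NormedAddCommGroup Z] [NormedSpace ℝ Z] [CompleteSpace Z],
        lipExtAdd n M Z ≤ ENNReal.ofReal (K * (Real.log n / Real.log (Real.log n)))) ∧
    (∀ (p : ℝ≥0∞) [Fact (1 ≤ p)], 1 < p → p ≤ 2 →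
      ∃ c : ℝ, 0 < c ∧ ∀ n : ℕ, 3 ≤ n →
        lipExtAdd n (ell p) (ell 2) ≤
          ENNReal.ofReal (c * Real.log n ^ (1 / p.toReal - 1 / 2))) ∧
    (∃ K : ℝ, 0 < K ∧ ∀ n : ℕ, 3 ≤ n →
      ∀ (Z : Type*) [NormedAddCommGroup Z] [NormedSpace ℝ Z] [CompleteSpace Z],
        lipExtAdd n (ell 2) Z ≤ ENNReal.ofReal (K * √(Real.log n))) ∧
    (∃ K : ℝ, 0 < K ∧ ∀ n : ℕ, 3 ≤ n →
      ∀ (Z : Type*) [NormedAddCommGroup Z] [NormedSpace ℝ Z] [CompleteSpace Z],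
        lipExtAdd n Z (ell 2) ≤ ENNReal.ofReal (K * √(Real.log n))) ∧
    (∀ (p : ℝ≥0∞) [Fact (1 ≤ p)], 1 < p → p ≤ 2 →
      ∃ c : ℝ, 0 < c ∧ ∀ n : ℕ, 3 ≤ n →
        ∀ (Z : Type*) [NormedAddCommGroup Z] [NormedSpace ℝ Z] [CompleteSpace Z],
          lipExtAdd n (ell p) Z ≤
            ENNReal.ofReal (c * Real.log n ^ (1 / p.toReal))) := by
  refine ⟨⟨2000, by norm_num, fun n hn M _ Z _ _ _ => lipExtAdd_le_log_div_loglog hn M Z⟩,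
    fun p _ hp1 hp2 => exists_lipExtAdd_ell_two_target hp1 hp2,
    ⟨70000, by norm_num, fun n hn Z _ _ _ => lipExtAdd_ell_two_banach hn Z⟩,
    ⟨300, by norm_num, fun n hn Z _ _ _ => ?_⟩,
    fun p _ hp1 hp2 => exists_lipExtAdd_ell_banach hp1 hp2⟩
  have hs1 : 1 ≤ √(Real.log n) := Real.one_le_sqrt.2 (one_le_log_of_three_le hn).le
  exact lipExtAdd_le_ofReal (finExt_inner_target Z (ell 2) hn) (by positivity) (by linarith)
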